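/- Let $\Theta_1,\Theta_2\subset\mathbb{R}^3$ be two disjoint, non-empty, smooth, compact, strictly convex sets (the obstacles), where strictly convex means convex with second fundamental form of the boundary bounded below by a positive constant. Let $\Omega=\mathbb{R}^3\setminus(\Theta_1\cup\Theta_2)$. For $x\in\Omega$, $\xi\neq 0$ and $t\ge 0$ let $\Phi_t(x,\xi)=(X_t(x,\xi),\Xi_t(x,\xi))$ be the position and velocity reached after following for a time $t$, at speed $|\xi|$, the ray that starts at $x$ in the direction $\xi$ and is reflected on the obstacles by the law $\xi\mapsto\xi-2(n\cdot\xi)n$, with $n$ the outward unit normal (at a time of reflection, $\Xi_t$ is the reflected velocity). Let $d$ be the Euclidean distance on $\mathbb{R}^3\times\mathbb{R}^3$, and let $\alpha_0,\beta_0>0$. Let $V$ be a bounded open set containing the convex hull of $\Theta_1\cup\Theta_2$. Then there exist $\alpha>0$, $C>0$ and $\tau>0$ such that for all $x,\tilde x\in V\cap\Omega$, all $\xi,\tilde\xi\in\mathbb{R}^3$ with $|\xi|,|\tilde\xi|\in[\alpha_0,\beta_0]$, and all $t>0$, there exists $t'\ge 0$ with $|t'-t|\le\tau$ such that \[ d\big(\Phi_{t'}(\tilde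 x,\tilde\xi),\Phi_{t'}(x,\xi)\big)\le C^{t'}\,d\big((\tilde x,\tilde\xi),(x,\xi)\big)^{\alpha}. \] -/

import Mathlib

open scoped ENNReal ContDiff RealInnerProductSpace

namespace Billiard

noncomputable section

/-- Euclidean three-space. -/
abbrev E3 : Type := EuclideanSpace ℝ (Fin 3)

/-- Phase space: pairs `(x, ξ)` of a point and a velocity. -/
abbrev Phase : Type := E3 × E3

/-- `g` is a smooth defining function of `Θ`: `Θ = {g ≤ 0}`, and the differential of `g` does not
vanish on `{g = 0}`, which is then the boundary of `Θ` and a smooth hypersurface. -/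
structure IsDefiningFunction (Θ : Set E3) (g : E3 → ℝ) : Prop where
  contDiff : ContDiff ℝ ∞ g
  eq_sublevel : Θ = {x | g x ≤ 0}
  regular : ∀ x, g x = 0 → fderiv ℝ g x ≠ 0

/-- The second fundamental form of the hypersurface `{g = 0}` at `x`, evaluated on `(v, v)` for a
tangent vector `v`; the sign is such that it is `‖v‖² / R` on the sphere
`{‖x‖² - R² = 0}`. -/
def secondFundamentalForm (g : E3 → ℝ) (x v : E3) : ℝ :=
  fderiv ℝ (fderiv ℝ g) x v v / ‖fderiv ℝ g x‖

/-- A (non-empty) smooth, compact, strictly convex subset of `ℝ³`, strict convexity meaning that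
the second fundamental form of the boundary is bounded below by a positive constant. -/
structure IsObstacle (Θ : Set E3) : Prop where
  nonempty : Θ.Nonempty
  isCompact : IsCompact Θ
  convex : Convex ℝ Θ
  smooth_strict : ∃ g : E3 → ℝ, IsDefiningFunction Θ g ∧
    ∃ κ : ℝ, 0 < κ ∧ ∀ x, g x = 0 → ∀ v, fderiv ℝ g x v = 0 →
      κ * ‖v‖ ^ 2 ≤ secondFundamentalForm g x v

/-- `n` is an outward unit normal at `y` to the convex set `Θ`. -/
def IsOutwardUnitNormal (Θ : Set E3) (y n : E3) : Prop :=
  ‖n‖ = 1 ∧ ∀ z ∈ Θ, ⟪n, z - y⟫ ≤ 0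

/-- At a boundary point of a convex set with smooth boundary there is exactly one outward unit
normal, the normalized gradient of a defining function. -/
theorem isOutwardUnitNormal_iff {Θ : Set E3} {g : E3 → ℝ} (hc : Convex ℝ Θ)
    (hg : IsDefiningFunction Θ g) {y : E3} (hy : g y = 0) (n : E3) :
    IsOutwardUnitNormal Θ y n ↔ n = ‖gradient g y‖⁻¹ • gradient g y := by
  have hd : DifferentiableAt ℝ g y := hg.contDiff.differentiable (by simp) y
  have hfd : ∀ v, fderiv ℝ g y v = ⟪gradient g y, v⟫ := fun v => by
    simp [gradient]
  set a := gradient g y with ha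
  have ha0 : a ≠ 0 := fun h => hg.regular y hy (by ext v; simp [hfd, h])
  have hap : 0 < ‖a‖ := norm_pos_iff.2 ha0
  have hyΘ : y ∈ Θ := by rw [hg.eq_sublevel]; exact hy.le
  have hline : ∀ v, HasDerivAt (fun s : ℝ => g (y + s • v)) ⟪a, v⟫ 0 := fun v => by
    have h1 : HasDerivAt (fun s : ℝ => y + s • v) v 0 := by
      simpa using ((hasDerivAt_id (0 : ℝ)).smul_const v).const_add y
    have h2 : HasFDerivAt g (fderiv ℝ g y) (y + (0 : ℝ) • v) := by
      simpa using hd.hasFDerivAt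
    have h3 := h2.comp_hasDerivAt (0 : ℝ) h1
    rw [hfd] at h3
    exact h3
  constructor
  · rintro ⟨hn1, hn⟩
    have key : ∀ v, ⟪a, v⟫ < 0 → ⟪n, v⟫ ≤ 0 := fun v hv => by
      have h1 := (hline v).tendsto_slope_zero_right.eventually (gt_mem_nhds hv)
      obtain ⟨s, hs, hs0⟩ := (h1.and self_mem_nhdsWithin).exists
      have hs0 : 0 < s := hs0
      have hz : y + s • v ∈ Θ := by
        rw [hg.eq_sublevel]
        simp only [zero_add, zero_smul, add_zero, hy, sub_zero, smul_eq_mul] at hs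
        have := (inv_mul_lt_iff₀ hs0).1 hs
        simpa using this.le
      have := hn _ hz
      rw [add_sub_cancel_left, inner_smul_right] at this
      exact nonpos_of_mul_nonpos_right this hs0
    have perp : ∀ w, ⟪a, w⟫ = 0 → ⟪n, w⟫ ≤ 0 := fun w hw => by
      refine le_of_forall_pos_le_add fun ε hε => ?_
      set δ := ε / (‖a‖ + 1) with hδ
      have hδ0 : 0 < δ := by positivity
      have h1 := key (w - δ • a) (by
        rw [inner_sub_right, inner_smul_right, hw, real_inner_self_eq_norm_sq]
        have : 0 < δ * ‖a‖ ^ 2 := by positivity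
        linarith)
      rw [inner_sub_right, inner_smul_right] at h1
      have h2 : ⟪n, a⟫ ≤ ‖a‖ := by simpa [hn1] using real_inner_le_norm n a
      have h3 : δ * ⟪n, a⟫ ≤ δ * (‖a‖ + 1) := by
        apply mul_le_mul_of_nonneg_left _ hδ0.le; linarith
      have h4 : δ * (‖a‖ + 1) = ε := by rw [hδ]; field_simp
      linarith
    have hna : 0 ≤ ⟪n, a⟫ := by
      have := key (-a) (by
        rw [inner_neg_right, real_inner_self_eq_norm_sq]
        have : 0 < ‖a‖ ^ 2 := by positivity
        linarith)
      rw [inner_neg_right] at this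
      linarith
    set c := ⟪n, a⟫ / ‖a‖ ^ 2 with hcdef
    have hw0 : ⟪a, n - c • a⟫ = 0 := by
      rw [inner_sub_right, inner_smul_right, real_inner_self_eq_norm_sq, real_inner_comm, hcdef]
      field_simp
      simp
    have hw1 := perp _ hw0
    have hw2 : ⟪n - c • a, n - c • a⟫ = ⟪n, n - c • a⟫ := by
      rw [inner_sub_left, inner_smul_left, hw0]; simp
    have hw3 : n - c • a = 0 := by
      rw [← hw2, real_inner_self_eq_norm_sq] at hw1
      exact norm_eq_zero.1 (pow_eq_zero_iff two_ne_zero |>.1 (le_antisymm hw1 (sq_nonneg _)))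
    have hnc : n = c • a := sub_eq_zero.1 hw3
    have hc0 : 0 ≤ c := by positivity
    have hc1 : c * ‖a‖ = 1 := by
      rw [hnc, norm_smul, Real.norm_of_nonneg hc0] at hn1; exact hn1
    rw [hnc, eq_inv_of_mul_eq_one_left hc1]
  · rintro rfl
    refine ⟨by rw [norm_smul, norm_inv, norm_norm, inv_mul_cancel₀ hap.ne'], fun z hz => ?_⟩
    rw [inner_smul_left]
    refine mul_nonpos_of_nonneg_of_nonpos (by simp) ?_
    have h1 := (hline (z - y)).tendsto_slope_zero_right
    refine le_of_tendsto h1 ?_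
    filter_upwards [Ioc_mem_nhdsGT (zero_lt_one : (0 : ℝ) < 1)] with s hs
    have h2 : y + s • (z - y) ∈ Θ := hc.add_smul_sub_mem hyΘ hz ⟨hs.1.le, hs.2⟩
    rw [hg.eq_sublevel] at h2
    have h3 : g (y + s • (z - y)) ≤ 0 := h2
    simp only [zero_add, zero_smul, add_zero, hy, sub_zero, smul_eq_mul]
    exact mul_nonpos_of_nonneg_of_nonpos (inv_nonneg.2 hs.1.le) h3

/-- The outward unit normal at a boundary point `y` of the convex set `Θ` with smooth boundary. -/
def outwardNormal (Θ : Set E3) (y : E3) : E3 :=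
  Classical.epsilon (IsOutwardUnitNormal Θ y)

theorem outwardNormal_eq {Θ : Set E3} {g : E3 → ℝ} (hc : Convex ℝ Θ)
    (hg : IsDefiningFunction Θ g) {y : E3} (hy : g y = 0) :
    outwardNormal Θ y = ‖gradient g y‖⁻¹ • gradient g y :=
  (isOutwardUnitNormal_iff hc hg hy _).1
    (Classical.epsilon_spec ⟨_, (isOutwardUnitNormal_iff hc hg hy _).2 rfl⟩)

open Classical in
/-- The normal `n(y)` at a point `y` of the boundary of one of two disjoint obstacles. -/
def normalAt (Θ₁ Θ₂ : Set E3) (y : E3) : E3 :=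
  if y ∈ Θ₁ then outwardNormal Θ₁ y else outwardNormal Θ₂ y

/-- The first strictly positive time at which the straight ray `s ↦ x + s ξ` meets `O`
(`⊤` if it never does). -/
def firstHit (O : Set E3) (p : Phase) : ℝ≥0∞ :=
  sInf (ENNReal.ofReal '' {s : ℝ | 0 < s ∧ p.1 + s • p.2 ∈ O})

/-- Follow the straight ray up to the first intersection with the obstacles and reflect the
velocity there: `ξ ↦ ξ - 2 (n · ξ) n`. At a tangential intersection the velocity is unchanged.
Only meaningful if the ray does meet the obstacles. -/
def bounce (Θ₁ Θ₂ : Set E3) (p : Phase) : Phase :=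
  let y := p.1 + (firstHit (Θ₁ ∪ Θ₂) p).toReal • p.2
  let n := normalAt Θ₁ Θ₂ y
  (y, p.2 - (2 * ⟪n, p.2⟫) • n)

/-- The position and velocity of the reflected ray starting from `p` just after its `i`-th
reflection. Only meaningful if there are at least `i` reflections. -/
def reflState (Θ₁ Θ₂ : Set E3) (p : Phase) (i : ℕ) : Phase :=
  (bounce Θ₁ Θ₂)^[i] p

/-- The time of the `i`-th reflection of the ray starting from `p` (`0` for `i = 0`, and `⊤` if
there are fewer than `i` reflections). -/
def reflTime (Θ₁ Θ₂ : Set E3) (p : Phase) (i : ℕ) : ℝ≥0∞ :=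
  ∑ j ∈ Finset.range i, firstHit (Θ₁ ∪ Θ₂) (reflState Θ₁ Θ₂ p j)

/-- The number of reflections in the time interval `(0, t]`. -/
def numRefl (Θ₁ Θ₂ : Set E3) (p : Phase) (t : ℝ) : ℕ :=
  sSup {i : ℕ | reflTime Θ₁ Θ₂ p i ≤ ENNReal.ofReal t}

/-- The billiard flow `Φ_t(x, ξ) = (X_t(x, ξ), Ξ_t(x, ξ))` in the exterior of `Θ₁ ∪ Θ₂` for
`t ≥ 0`: follow the reflected ray at speed `|ξ|` during the time `t`. At a time of reflection the
velocity is the reflected one. -/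
def flow (Θ₁ Θ₂ : Set E3) (t : ℝ) (p : Phase) : Phase :=
  let N := numRefl Θ₁ Θ₂ p t
  let q := reflState Θ₁ Θ₂ p N
  (q.1 + (t - (reflTime Θ₁ Θ₂ p N).toReal) • q.2, q.2)

/-- The Euclidean distance on phase space `ℝ³ × ℝ³`. -/
def phaseDist (p q : Phase) : ℝ :=
  √(dist p.1 q.1 ^ 2 + dist p.2 q.2 ^ 2)

end

end Billiard

open scoped ENNReal ContDiff RealInnerProductSpace

namespace Billiard

/-! Reflection depends on the incoming ray in a Lipschitz way at transversal hits, but only with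
Hölder exponent 1/2 at grazing ones, and a long composition of square roots would destroy the
exponent. The way out is that a reflection on `B` between two visits to `A` cannot be grazing: the
segment joining the two visits lies in the convex set `A`, at distance at least `D` from `B`, so the
ray must bend by a definite amount to reach `B` in between (`IsPair.le_of_middle`). Only the first
and the last reflection can cost a square root, whence the exponent 1/4.

Two nearby rays hit the same obstacle at different times, and between these times their velocities
may be far apart. They are therefore compared at the later of the two times, when both move away
from the obstacle (`exists_sync_of_hit`); this accounts for the bounded delay between `t` and `t'`.
If one ray hits and the other misses, the hit is grazing and hardly turns the ray
(`exists_sync_of_miss`).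

Iterating these steps (`exists_step`, `exists_comparison_of_isOut`) multiplies the distance by a
constant each time, until a possible last square root followed by free motion. A step lasts at least
`D / (2 * β)`, so their number is linear in time and the total factor exponential. The iteration
needs the distance to stay small; when the initial distance is too large for that, the linear growth
of the flow is enough (`IsPair.flow_bound`). -/

/-! ### Round sets: support planes, inner balls, tangent lines -/

/-- `Θ` is a closed convex set with a field `n` of outward unit normals on its boundary, in which a
ball of radius `r` rolls freely and which is touched by its tangent lines in a single point. -/
structure IsRound (Θ : Set E3) (n : E3 → E3) (r : ℝ) : Prop where
  isClosed : IsClosed Θ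
  convex : Convex ℝ Θ
  pos : 0 < r
  norm_normal : ∀ y ∈ frontier Θ, ‖n y‖ = 1
  support : ∀ y ∈ frontier Θ, ∀ z ∈ Θ, ⟪n y, z - y⟫ ≤ 0
  ball : ∀ y ∈ frontier Θ, Metric.closedBall (y - r • n y) r ⊆ Θ
  tangent : ∀ y ∈ frontier Θ, ∀ v, v ≠ 0 → ⟪n y, v⟫ = 0 → y + v ∉ Θ

theorem IsRound.mono {Θ : Set E3} {n : E3 → E3} {r s : ℝ} (h : IsRound Θ n r) (hs : 0 < s)
    (hsr : s ≤ r) : IsRound Θ n s where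
  isClosed := h.isClosed
  convex := h.convex
  pos := hs
  norm_normal := h.norm_normal
  support := h.support
  ball y hy := by
    refine (Metric.closedBall_subset_closedBall' ?_).trans (h.ball y hy)
    have : y - s • n y - (y - r • n y) = (r - s) • n y := by module
    rw [dist_eq_norm, this, norm_smul, h.norm_normal y hy, Real.norm_of_nonneg (by linarith)]
    linarith
  tangent := h.tangent

theorem IsRound.congr {Θ : Set E3} {n m : E3 → E3} {r : ℝ} (h : IsRound Θ n r)
    (hm : ∀ y ∈ Θ, m y = n y) : IsRound Θ m r := by
  have hf : ∀ y ∈ frontier Θ, m y = n y := fun y hy => hm y (h.isClosed.frontier_subset hy)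
  refine ⟨h.isClosed, h.convex, h.pos, fun y hy => ?_, fun y hy => ?_, fun y hy => ?_,
    fun y hy => ?_⟩ <;> rw [hf y hy]
  exacts [h.norm_normal y hy, h.support y hy, h.ball y hy, h.tangent y hy]

/-- The normals of a set in which a ball rolls freely are Lipschitz. -/
theorem IsRound.norm_normal_sub_le {Θ : Set E3} {n : E3 → E3} {r : ℝ} (h : IsRound Θ n r)
    {y z : E3} (hy : y ∈ frontier Θ) (hz : z ∈ frontier Θ) :
    r * ‖n y - n z‖ ≤ ‖y - z‖ := by
  have hr := h.pos
  have hny := h.norm_normal y hy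
  have hnz := h.norm_normal z hz
  -- The support inequality at `z` for this point of the inner ball at `y`, added to its mirror
  -- image, gives `r * ‖n y - n z‖ ^ 2 ≤ ⟪n y - n z, y - z⟫`.
  have h1 : y - r • n y + r • n z ∈ Θ := h.ball y hy (by
    rw [Metric.mem_closedBall, dist_eq_norm, add_sub_cancel_left, norm_smul, hnz,
      Real.norm_of_nonneg hr.le, mul_one])
  have h2 : z - r • n z + r • n y ∈ Θ := h.ball z hz (by
    rw [Metric.mem_closedBall, dist_eq_norm, add_sub_cancel_left, norm_smul, hny,
      Real.norm_of_nonneg hr.le, mul_one])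
  have h3 := h.support z hz _ h1
  have h4 := h.support y hy _ h2
  have h5 : r * ‖n y - n z‖ ^ 2 = ⟪n z, y - r • n y + r • n z - z⟫
      + ⟪n y, z - r • n z + r • n y - y⟫ + ⟪n y - n z, y - z⟫ := by
    rw [← real_inner_self_eq_norm_sq]
    simp only [inner_sub_left, inner_sub_right, inner_add_right, inner_smul_right]
    rw [real_inner_comm (n y) (n z)]
    ring
  have h6 := real_inner_le_norm (n y - n z) (y - z)
  by_cases h0 : ‖n y - n z‖ = 0
  · rw [h0, mul_zero]; exact norm_nonneg _
  · have h7 : 0 < ‖n y - n z‖ := lt_of_le_of_ne (norm_nonneg _) (Ne.symm h0)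
    nlinarith

/-! ### Smooth strictly convex obstacles are round -/

theorem IsDefiningFunction.frontier_eq_zero {Θ : Set E3} {g : E3 → ℝ}
    (hg : IsDefiningFunction Θ g) {y : E3} (hy : y ∈ frontier Θ) : g y = 0 := by
  rw [hg.eq_sublevel] at hy
  exact frontier_le_subset_eq hg.contDiff.continuous continuous_const hy

/-- A quadratic upper bound of a smooth function, uniform on a bounded set. -/
theorem exists_taylor_le {g : E3 → ℝ} (hg : ContDiff ℝ ∞ g) (R : ℝ) :
    ∃ K : ℝ, 0 < K ∧ ∀ y z : E3, ‖y‖ ≤ R → ‖z‖ ≤ R →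
      g z ≤ g y + fderiv ℝ g y (z - y) + K * ‖z - y‖ ^ 2 := by
  have hdg : ContDiff ℝ ∞ (fderiv ℝ g) := hg.fderiv_right (m := ∞) (by simp)
  have hcont : Continuous (fderiv ℝ (fderiv ℝ g)) := hdg.continuous_fderiv (by simp)
  obtain ⟨K, hK⟩ := (isCompact_closedBall (0 : E3) R).exists_bound_of_continuousOn
    (f := fderiv ℝ (fderiv ℝ g)) hcont.continuousOn
  refine ⟨max K 1, by positivity, fun y z hy hz => ?_⟩
  have hconv := convex_closedBall (0 : E3) R
  have hseg : segment ℝ y z ⊆ Metric.closedBall 0 R :=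
    hconv.segment_subset (by simpa using hy) (by simpa using hz)
  have hlip : ∀ w ∈ segment ℝ y z, ‖fderiv ℝ g w - fderiv ℝ g y‖ ≤ max K 1 * ‖z - y‖ := by
    intro w hw
    refine (hconv.norm_image_sub_le_of_norm_fderiv_le
      (fun v _ => hdg.differentiable (by simp) v)
      (fun v hv => (hK v hv).trans (le_max_left K 1)) (by simpa using hy) (hseg hw)).trans ?_
    gcongr
    rw [segment_eq_image'] at hw
    obtain ⟨s, hs, rfl⟩ := hw
    rw [add_sub_cancel_left, norm_smul, Real.norm_of_nonneg hs.1]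
    exact mul_le_of_le_one_left (norm_nonneg _) hs.2
  have h1 := (convex_segment y z).norm_image_sub_le_of_norm_fderiv_le'
    (fun v _ => hg.differentiable (by simp) v) hlip (left_mem_segment ℝ y z)
    (right_mem_segment ℝ y z)
  have h2 := (le_abs_self _).trans h1
  nlinarith

/-- A tangent line leaves the sublevel set when the second derivative of the defining function is
positive along it. -/
theorem exists_pos_of_second_deriv_pos {g : E3 → ℝ} (hg : ContDiff ℝ ∞ g) {y v : E3}
    (h0 : g y = 0) (h1 : fderiv ℝ g y v = 0) (h2 : 0 < fderiv ℝ (fderiv ℝ g) y v v) :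
    ∃ s ∈ Set.Ioo (0 : ℝ) 1, 0 < g (y + s • v) := by
  have hdg : ContDiff ℝ ∞ (fderiv ℝ g) := hg.fderiv_right (m := ∞) (by simp)
  have hl : ∀ s : ℝ, HasDerivAt (fun s : ℝ => y + s • v) v s := fun s => by
    simpa using ((hasDerivAt_id s).smul_const v).const_add y
  have hφ : ∀ s : ℝ, HasDerivAt (fun s : ℝ => g (y + s • v)) (fderiv ℝ g (y + s • v) v) s :=
    fun s => (hg.differentiable (by simp) _).hasFDerivAt.comp_hasDerivAt s (hl s)
  have hψ : HasDerivAt (fun s : ℝ => fderiv ℝ g (y + s • v) v)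
      (fderiv ℝ (fderiv ℝ g) y v v) 0 := by
    have h3 : HasFDerivAt (fderiv ℝ g) (fderiv ℝ (fderiv ℝ g) y) (y + (0 : ℝ) • v) := by
      simpa using (hdg.differentiable (by simp) y).hasFDerivAt
    have h4 := h3.comp_hasDerivAt (0 : ℝ) (hl 0)
    have h5 := h4.clm_apply (hasDerivAt_const (0 : ℝ) v)
    simpa using h5
  -- The derivative along the line vanishes at 0 with positive slope, so it is positive just to the
  -- right of 0 and `g` increases there.
  have h6 := hψ.tendsto_slope_zero_right.eventually (lt_mem_nhds h2)
  rw [eventually_nhdsWithin_iff, Metric.eventually_nhds_iff] at h6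
  obtain ⟨δ, hδ, h7⟩ := h6
  set b := min (δ / 2) (1 / 2) with hb
  have hb0 : 0 < b := by positivity
  have hbδ : b < δ := (min_le_left _ _).trans_lt (by linarith)
  have hb1 : b < 1 := (min_le_right _ _).trans_lt (by norm_num)
  refine ⟨b, ⟨hb0, hb1⟩, ?_⟩
  have hmono : StrictMonoOn (fun s : ℝ => g (y + s • v)) (Set.Icc 0 b) := by
    refine strictMonoOn_of_deriv_pos (convex_Icc 0 b)
      (fun s _ => (hφ s).continuousAt.continuousWithinAt) fun s hs => ?_
    rw [interior_Icc] at hs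
    rw [(hφ s).deriv]
    have h8 := h7 (y := s) (by rw [Real.dist_eq, sub_zero, abs_of_pos hs.1]; linarith [hs.2]) hs.1
    simp only [zero_add, zero_smul, add_zero, h1, sub_zero, smul_eq_mul] at h8
    exact (pos_iff_pos_of_mul_pos h8).1 (inv_pos.2 hs.1)
  have := hmono (Set.left_mem_Icc.2 hb0.le) (Set.right_mem_Icc.2 hb0.le) hb0
  simpa [h0] using this

/-- Smooth strictly convex obstacles are round. -/
theorem IsObstacle.exists_isRound {Θ : Set E3} (h : IsObstacle Θ) :
    ∃ r, IsRound Θ (outwardNormal Θ) r := by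
  obtain ⟨g, hg, κ, hκ, hff⟩ := h.smooth_strict
  obtain ⟨R, hR⟩ := h.isCompact.isBounded.exists_norm_le
  -- The margin 2 covers the inner balls, whose diameter is at most 2.
  obtain ⟨K, hK0, hK⟩ := exists_taylor_le hg.contDiff (R + 2)
  have hn : ∀ y ∈ frontier Θ, outwardNormal Θ y = ‖gradient g y‖⁻¹ • gradient g y :=
    fun y hy => outwardNormal_eq h.convex hg (hg.frontier_eq_zero hy)
  have hnorm : ∀ y ∈ frontier Θ, IsOutwardUnitNormal Θ y (outwardNormal Θ y) := fun y hy =>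
    (isOutwardUnitNormal_iff h.convex hg (hg.frontier_eq_zero hy) _).2 (hn y hy)
  have hfd : ∀ y v, fderiv ℝ g y v = ⟪gradient g y, v⟫ := fun y v => by simp [gradient]
  have hfn : ∀ y, ‖gradient g y‖ = ‖fderiv ℝ g y‖ := fun y => by simp [gradient]
  have hpos : ∀ y ∈ frontier Θ, 0 < ‖fderiv ℝ g y‖ := fun y hy =>
    norm_pos_iff.2 (hg.regular y (hg.frontier_eq_zero hy))
  have hcompact : IsCompact (frontier Θ) :=
    h.isCompact.of_isClosed_subset isClosed_frontier h.isCompact.isClosed.frontier_subset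
  have hdg : ContDiff ℝ ∞ (fderiv ℝ g) := hg.contDiff.fderiv_right (m := ∞) (by simp)
  obtain ⟨c, hc0, hc⟩ : ∃ c : ℝ, 0 < c ∧ ∀ y ∈ frontier Θ, c ≤ ‖fderiv ℝ g y‖ :=
    hcompact.exists_forall_le' hdg.continuous.norm.continuousOn hpos
  have hfn' : ∀ y ∈ frontier Θ, ∀ v,
      fderiv ℝ g y v = ‖fderiv ℝ g y‖ * ⟪outwardNormal Θ y, v⟫ := fun y hy v => by
    rw [hn y hy, hfd, inner_smul_left, ← hfn]
    have : ‖gradient g y‖ ≠ 0 := by rw [hfn]; exact (hpos y hy).ne'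
    simp
    field_simp
  -- On the inner ball `‖z - y‖ ^ 2 ≤ -2 * r * ⟪m, z - y⟫`, so the quadratic Taylor term is
  -- dominated by the linear one as soon as `2 * r * K ≤ c`.
  refine ⟨min 1 (c / (2 * K)), h.isCompact.isClosed, h.convex, by positivity,
    fun y hy => (hnorm y hy).1, fun y hy => (hnorm y hy).2, fun y hy z hz => ?_,
    fun y hy v hv hv0 hmem => ?_⟩
  · set r := min 1 (c / (2 * K)) with hr
    have hr0 : 0 < r := by positivity
    have hr1 : r ≤ 1 := min_le_left _ _
    have hr2 : r * (2 * K) ≤ c := by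
      rw [← le_div_iff₀ (by positivity)]; exact min_le_right _ _
    set m := outwardNormal Θ y
    have hm1 : ‖m‖ = 1 := (hnorm y hy).1
    have hyR := hR y (h.isCompact.isClosed.frontier_subset hy)
    rw [Metric.mem_closedBall, dist_eq_norm] at hz
    have hz2 : z - (y - r • m) = (z - y) + r • m := by abel
    rw [hz2] at hz
    have hzy : ‖z - y‖ ≤ 2 := by
      have h1 : z - y = ((z - y) + r • m) - r • m := by abel
      rw [h1]
      refine (norm_sub_le _ _).trans ?_
      rw [norm_smul, hm1, Real.norm_of_nonneg hr0.le]
      linarith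
    have hsq : ‖z - y‖ ^ 2 ≤ -(2 * r * ⟪m, z - y⟫) := by
      have h1 : ‖(z - y) + r • m‖ ^ 2 ≤ r ^ 2 := by gcongr
      rw [norm_add_sq_real, norm_smul, hm1, Real.norm_of_nonneg hr0.le, inner_smul_right,
        real_inner_comm] at h1
      linarith
    have hzR : ‖z‖ ≤ R + 2 := by
      have h1 : z = y + (z - y) := by abel
      rw [h1]
      exact (norm_add_le _ _).trans (by linarith)
    have h1 := hK y z (by linarith) hzR
    rw [hg.frontier_eq_zero hy, hfn' y hy] at h1
    rw [hg.eq_sublevel]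
    change g z ≤ 0
    have h2 := hc y hy
    have h3 : ⟪m, z - y⟫ ≤ 0 := by nlinarith [sq_nonneg ‖z - y‖]
    have h4 : ‖fderiv ℝ g y‖ * ⟪m, z - y⟫ ≤ c * ⟪m, z - y⟫ :=
      mul_le_mul_of_nonpos_right h2 h3
    have h5 : c * ⟪m, z - y⟫ ≤ r * (2 * K) * ⟪m, z - y⟫ := mul_le_mul_of_nonpos_right hr2 h3
    have h6 : K * ‖z - y‖ ^ 2 ≤ K * -(2 * r * ⟪m, z - y⟫) := by gcongr
    linarith
  · have hy0 := hg.frontier_eq_zero hy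
    have h1 : fderiv ℝ g y v = 0 := by rw [hfn' y hy, hv0, mul_zero]
    have h2 : 0 < fderiv ℝ (fderiv ℝ g) y v v := by
      have h3 := hff y hy0 v h1
      rw [secondFundamentalForm, le_div_iff₀ (hpos y hy)] at h3
      have h4 : 0 < ‖v‖ := norm_pos_iff.2 hv
      have := hpos y hy
      have : 0 < κ * ‖v‖ ^ 2 * ‖fderiv ℝ g y‖ := by positivity
      linarith
    obtain ⟨s, hs, h3⟩ := exists_pos_of_second_deriv_pos hg.contDiff hy0 h1 h2
    have h4 : y + s • v ∈ Θ := by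
      have := h.convex.add_smul_mem (h.isCompact.isClosed.frontier_subset hy) hmem
        ⟨hs.1.le, hs.2.le⟩
      exact this
    rw [hg.eq_sublevel] at h4
    exact absurd h3 (not_lt.2 h4)

/-! ### Straight rays and first hits -/

/-- The free motion along straight lines. -/
noncomputable def free (s : ℝ) (p : Phase) : Phase := (p.1 + s • p.2, p.2)

@[simp] theorem free_snd (s : ℝ) (p : Phase) : (free s p).2 = p.2 := rfl

theorem free_fst (s : ℝ) (p : Phase) : (free s p).1 = p.1 + s • p.2 := rfl

@[simp] theorem free_zero (p : Phase) : free 0 p = p := by simp [free]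

theorem free_free (s t : ℝ) (p : Phase) : free s (free t p) = free (t + s) p := by
  simp only [free, Prod.mk.injEq, and_true]; module

theorem continuous_free_fst (p : Phase) : Continuous fun s => (free s p).1 := by
  unfold free; fun_prop

/-- The straight ray from `p` meets `O` at time `h` for the first time after `0`. -/
structure IsFirstHit (O : Set E3) (p : Phase) (h : ℝ) : Prop where
  pos : 0 < h
  mem : (free h p).1 ∈ O
  before : ∀ s, 0 < s → s < h → (free s p).1 ∉ O

theorem IsFirstHit.firstHit_eq {O : Set E3} {p : Phase} {h : ℝ} (hh : IsFirstHit O p h) :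
    firstHit O p = ENNReal.ofReal h := by
  refine le_antisymm (sInf_le ⟨h, ⟨hh.pos, hh.mem⟩, rfl⟩) (le_sInf ?_)
  rintro _ ⟨s, ⟨hs, hsO⟩, rfl⟩
  refine ENNReal.ofReal_le_ofReal (not_lt.1 fun hlt => hh.before s hs hlt hsO)

theorem firstHit_eq_top {O : Set E3} {p : Phase} (h : ∀ s, 0 < s → (free s p).1 ∉ O) :
    firstHit O p = ⊤ := by
  have : {s : ℝ | 0 < s ∧ p.1 + s • p.2 ∈ O} = ∅ := by
    ext s
    simp only [Set.mem_ofPred_eq, Set.mem_empty_iff_false, iff_false, not_and]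
    exact h s
  rw [firstHit, this, Set.image_empty, sInf_empty]

theorem IsFirstHit.free {O : Set E3} {p : Phase} {h v : ℝ} (hh : IsFirstHit O p h) (hv : 0 ≤ v)
    (hvh : v < h) : IsFirstHit O (free v p) (h - v) where
  pos := by linarith
  mem := by rw [free_free, add_sub_cancel]; exact hh.mem
  before s hs hsv := by rw [free_free]; exact hh.before _ (by linarith) (by linarith)

theorem exists_isFirstHit {O : Set E3} (hO : IsClosed O) {p : Phase} (hp : p.1 ∉ O) {s : ℝ}
    (hs : 0 < s) (hsO : (free s p).1 ∈ O) : ∃ h, h ≤ s ∧ IsFirstHit O p h := by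
  -- Admitting time 0 makes `S` closed, so its infimum is attained; it is positive because the ray
  -- starts outside `O`.
  set S := {u : ℝ | 0 ≤ u ∧ (free u p).1 ∈ O} with hS
  have hSc : IsClosed S := isClosed_Ici.inter (hO.preimage (continuous_free_fst p))
  have hSb : BddBelow S := ⟨0, fun u hu => hu.1⟩
  have hmem := hSc.csInf_mem ⟨s, hs.le, hsO⟩ hSb
  refine ⟨sInf S, csInf_le hSb ⟨hs.le, hsO⟩, lt_of_le_of_ne hmem.1 fun h0 => ?_, hmem.2,
    fun u hu hlt huO => ?_⟩
  · have := hmem.2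
    rw [← h0, free_zero] at this
    exact hp this
  · exact absurd (csInf_le hSb ⟨hu.le, huO⟩) (not_le.2 hlt)

/-- The ray from `p` either misses `O` or meets it for a first time. -/
def IsTame (O : Set E3) (p : Phase) : Prop :=
  (∀ s, 0 < s → (free s p).1 ∉ O) ∨ ∃ h, IsFirstHit O p h

theorem isTame_of_notMem {O : Set E3} (hO : IsClosed O) {p : Phase} (hp : p.1 ∉ O) :
    IsTame O p := by
  by_cases h : ∀ s, 0 < s → (free s p).1 ∉ O
  · exact .inl h
  · push Not at h
    obtain ⟨s, hs, hsO⟩ := h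
    obtain ⟨h, -, hh⟩ := exists_isFirstHit hO hp hs hsO
    exact .inr ⟨h, hh⟩

theorem IsFirstHit.mem_frontier {O : Set E3} (hO : IsClosed O) {p : Phase} {h : ℝ}
    (hh : IsFirstHit O p h) : (Billiard.free h p).1 ∈ frontier O := by
  rw [hO.frontier_eq]
  refine ⟨hh.mem, fun hint => ?_⟩
  have h1 := (isOpen_interior.preimage (continuous_free_fst p)).mem_nhds hint
  have h2 : ∀ᶠ s in nhdsWithin h (Set.Iio h), (Billiard.free s p).1 ∈ interior O :=
    nhdsWithin_le_nhds h1
  have h3 : ∀ᶠ s in nhdsWithin h (Set.Iio h), 0 < s :=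
    nhdsWithin_le_nhds (lt_mem_nhds hh.pos)
  obtain ⟨s, ⟨hs1, hs2⟩, hs3⟩ := ((h2.and h3).and self_mem_nhdsWithin).exists
  exact hh.before s hs2 hs3 (interior_subset hs1)

/-- A ray enters a round set against the outward normal. -/
theorem IsFirstHit.inner_nonpos {O : Set E3} {n : E3 → E3} {r : ℝ} (hO : IsRound O n r)
    {p : Phase} {h : ℝ} (hh : IsFirstHit O p h) : ⟪n (Billiard.free h p).1, p.2⟫ ≤ 0 := by
  have hy := hh.mem_frontier hO.isClosed
  set y := (Billiard.free h p).1 with hydef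
  have hr := hO.pos
  have hpos := hh.pos
  by_contra! hc
  set c := ⟪n y, p.2⟫ with hcdef
  have hv : 0 < ‖p.2‖ := norm_pos_iff.2 fun h0 => by simp [hcdef, h0] at hc
  -- If the ray moved outward at the hit, it would lie in the inner ball at the time `s` earlier;
  -- the bound `h / 2` keeps that time positive.
  set s := min (h / 2) (2 * r * c / ‖p.2‖ ^ 2) with hs
  have hs0 : 0 < s := by positivity
  have hsh : s ≤ h / 2 := min_le_left _ _
  have hs2 : s * ‖p.2‖ ^ 2 ≤ 2 * r * c := by
    rw [← le_div_iff₀ (by positivity)]; exact min_le_right _ _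
  refine hh.before (h - s) (by linarith) (by linarith) (hO.ball y hy ?_)
  have h1 : (Billiard.free (h - s) p).1 = y - s • p.2 := by
    simp only [hydef, free_fst]; module
  have h2 : y - s • p.2 - (y - r • n y) = r • n y - s • p.2 := by abel
  rw [h1, Metric.mem_closedBall, dist_eq_norm, h2]
  refine abs_le_of_sq_le_sq' ?_ hr.le |>.2
  rw [norm_sub_sq_real, norm_smul, norm_smul, hO.norm_normal y hy, Real.norm_of_nonneg hr.le,
    Real.norm_of_nonneg hs0.le, inner_smul_left, inner_smul_right]
  simp only [conj_trivial]
  nlinarith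

/-! ### Reflections and the recursive structure of the flow -/

theorem norm_reflection {m ξ : E3} (hm : ‖m‖ = 1) : ‖ξ - (2 * ⟪m, ξ⟫) • m‖ = ‖ξ‖ := by
  refine (sq_eq_sq₀ (norm_nonneg _) (norm_nonneg _)).1 ?_
  rw [norm_sub_sq_real, inner_smul_right, norm_smul, hm, real_inner_comm, Real.norm_eq_abs,
    mul_one, sq_abs]
  ring

theorem inner_reflection {m ξ : E3} (hm : ‖m‖ = 1) :
    ⟪m, ξ - (2 * ⟪m, ξ⟫) • m⟫ = -⟪m, ξ⟫ := by
  rw [inner_sub_right, inner_smul_right, real_inner_self_eq_norm_sq, hm]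
  ring

/-- `A` and `B` are the two obstacles, in one of the two orders: round sets at mutual distance at
least `D` in a ball of radius `R`. -/
structure IsPair (Θ₁ Θ₂ A B : Set E3) (r D R : ℝ) : Prop where
  union_eq : A ∪ B = Θ₁ ∪ Θ₂
  left : IsRound A (normalAt Θ₁ Θ₂) r
  right : IsRound B (normalAt Θ₁ Θ₂) r
  gap_pos : 0 < D
  gap : ∀ a ∈ A, ∀ b ∈ B, D ≤ dist a b
  norm_le : ∀ z ∈ A ∪ B, ‖z‖ ≤ R

section

variable {Θ₁ Θ₂ A B : Set E3} {r D R : ℝ} {q : Phase} {h t u v : ℝ}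

theorem IsPair.symm (hP : IsPair Θ₁ Θ₂ A B r D R) : IsPair Θ₁ Θ₂ B A r D R where
  union_eq := by rw [Set.union_comm, hP.union_eq]
  left := hP.right
  right := hP.left
  gap_pos := hP.gap_pos
  gap b hb a ha := by rw [dist_comm]; exact hP.gap a ha b hb
  norm_le z hz := hP.norm_le z (Set.union_comm B A ▸ hz)

theorem IsPair.isClosed (hP : IsPair Θ₁ Θ₂ A B r D R) : IsClosed (A ∪ B) :=
  hP.left.isClosed.union hP.right.isClosed

theorem IsPair.disjoint (hP : IsPair Θ₁ Θ₂ A B r D R) {z : E3} (hA : z ∈ A) : z ∉ B := fun hB => by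
  have := hP.gap z hA z hB
  rw [dist_self] at this
  exact absurd hP.gap_pos (not_lt.2 this)

/-- The state just after the reflection at time `h`. -/
noncomputable def bounceAt (Θ₁ Θ₂ : Set E3) (h : ℝ) (q : Phase) : Phase :=
  ((free h q).1, q.2 - (2 * ⟪normalAt Θ₁ Θ₂ (free h q).1, q.2⟫) • normalAt Θ₁ Θ₂ (free h q).1)

theorem IsFirstHit.bounce_eq (hh : IsFirstHit (Θ₁ ∪ Θ₂) q h) :
    bounce Θ₁ Θ₂ q = bounceAt Θ₁ Θ₂ h q := by
  simp only [bounce, bounceAt, hh.firstHit_eq, ENNReal.toReal_ofReal hh.pos.le, free_fst]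

theorem bounceAt_free : bounceAt Θ₁ Θ₂ (h - v) (free v q) = bounceAt Θ₁ Θ₂ h q := by
  simp only [bounceAt, free_free, add_sub_cancel, free_snd]

theorem IsFirstHit.subset {O O' : Set E3} (hh : IsFirstHit O q h) (hsub : O' ⊆ O)
    (hmem : (Billiard.free h q).1 ∈ O') : IsFirstHit O' q h :=
  ⟨hh.pos, hmem, fun s hs hsh hs' => hh.before s hs hsh (hsub hs')⟩

/-- `q` starts on `A` and moves away from it. -/
def Leaves (A : Set E3) (q : Phase) : Prop :=
  q.1 ∈ A ∧ ∀ s, 0 < s → (free s q).1 ∉ A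

theorem IsPair.norm_bounceAt (hP : IsPair Θ₁ Θ₂ A B r D R) (hh : IsFirstHit B q h) :
    ‖(bounceAt Θ₁ Θ₂ h q).2‖ = ‖q.2‖ :=
  norm_reflection (hP.right.norm_normal _ (hh.mem_frontier hP.right.isClosed))

/-- After a transversal hit the velocity points strictly out of the support half-space; after a
tangential one the ray follows a tangent line, which touches a round set only once. -/
theorem IsPair.leaves_bounceAt (hP : IsPair Θ₁ Θ₂ A B r D R) (hh : IsFirstHit B q h)
    (hq : q.2 ≠ 0) : Leaves B (bounceAt Θ₁ Θ₂ h q) := by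
  refine ⟨hh.mem, fun s hs hmem => ?_⟩
  have hy := hh.mem_frontier hP.right.isClosed
  have hc := hh.inner_nonpos hP.right
  have hn := hP.right.norm_normal _ hy
  have h1 : ⟪normalAt Θ₁ Θ₂ (free h q).1, (bounceAt Θ₁ Θ₂ h q).2⟫ =
    -⟪normalAt Θ₁ Θ₂ (free h q).1, q.2⟫ := inner_reflection hn
  have h2 : (bounceAt Θ₁ Θ₂ h q).2 ≠ 0 := by
    rw [← norm_pos_iff, hP.norm_bounceAt hh]; exact norm_pos_iff.2 hq
  rcases hc.lt_or_eq with hc | hc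
  · have h3 := hP.right.support _ hy _ hmem
    rw [free_fst s, show (bounceAt Θ₁ Θ₂ h q).1 = (free h q).1 from rfl, add_sub_cancel_left,
      inner_smul_right, h1] at h3
    nlinarith
  · exact hP.right.tangent _ hy (s • (bounceAt Θ₁ Θ₂ h q).2) (smul_ne_zero hs.ne' h2)
      (by rw [inner_smul_right, h1, hc]; simp) hmem

theorem IsPair.isFirstHit_iff_of_leaves (hP : IsPair Θ₁ Θ₂ A B r D R)
    (hq : ∀ s, 0 < s → (free s q).1 ∉ A) : IsFirstHit (Θ₁ ∪ Θ₂) q h ↔ IsFirstHit B q h := by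
  rw [← hP.union_eq]
  constructor
  · intro hh
    exact hh.subset Set.subset_union_right (hh.mem.resolve_left (hq h hh.pos))
  · intro hh
    exact ⟨hh.pos, .inr hh.mem, fun s hs hsh hs' =>
      hs'.elim (hq s hs) (hh.before s hs hsh)⟩

/-- A ray leaving `A`, without meeting `A` again, is tame unless it starts on `B`. -/
theorem IsPair.isTame_of_leaves (hP : IsPair Θ₁ Θ₂ A B r D R)
    (hq : ∀ s, 0 < s → (free s q).1 ∉ A) (hB : q.1 ∉ B) : IsTame (Θ₁ ∪ Θ₂) q := by
  rcases isTame_of_notMem hP.right.isClosed hB with h1 | ⟨h, hh⟩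
  · left
    rw [← hP.union_eq]
    exact fun s hs hs' => hs'.elim (hq s hs) (h1 s hs)
  · exact .inr ⟨h, (hP.isFirstHit_iff_of_leaves hq).2 hh⟩

theorem IsPair.gap_le (hP : IsPair Θ₁ Θ₂ A B r D R) (hq : q.1 ∈ A) (hh : IsFirstHit B q h) :
    D ≤ h * ‖q.2‖ := by
  have := hP.gap _ hq _ hh.mem
  rwa [free_fst, dist_eq_norm, sub_add_cancel_left, norm_neg, norm_smul,
    Real.norm_of_nonneg hh.pos.le] at this

theorem reflTime_succ (q : Phase) (i : ℕ) : reflTime Θ₁ Θ₂ q (i + 1) =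
    firstHit (Θ₁ ∪ Θ₂) q + reflTime Θ₁ Θ₂ (bounce Θ₁ Θ₂ q) i := by
  simp only [reflTime, reflState, Finset.sum_range_succ', Function.iterate_succ_apply,
    Function.iterate_zero, id_eq]
  rw [add_comm]

/-- Reflections alternate between the obstacles, so each flight crosses the gap `D` at constant
speed. -/
theorem IsPair.le_reflTime (hP : IsPair Θ₁ Θ₂ A B r D R) (hq : Leaves A q) (hq0 : q.2 ≠ 0)
    (i : ℕ) : ENNReal.ofReal (i * (D / ‖q.2‖)) ≤ reflTime Θ₁ Θ₂ q i := by
  induction i generalizing A B q with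
  | zero => simp
  | succ i ih =>
    rw [reflTime_succ]
    have hv := norm_pos_iff.2 hq0
    rcases hP.isTame_of_leaves hq.2 (hP.disjoint hq.1) with h1 | ⟨h, hh⟩
    · rw [firstHit_eq_top h1]; simp
    · have hhB := (hP.isFirstHit_iff_of_leaves hq.2).1 hh
      have hn := hP.norm_bounceAt hhB
      have h1 := ih hP.symm (hP.leaves_bounceAt hhB hq0) (by
        rw [← norm_pos_iff, hn]; exact hv)
      rw [hn] at h1
      rw [hh.bounce_eq, hh.firstHit_eq]
      refine le_trans ?_ (add_le_add le_rfl h1)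
      have hg := hP.gap_pos
      rw [← ENNReal.ofReal_add hh.pos.le (by positivity)]
      apply ENNReal.ofReal_le_ofReal
      have := hP.gap_le hq.1 hhB
      rw [← div_le_iff₀ hv] at this
      push_cast
      linarith

/-- The supremum defining `numRefl` would take the default value 0 on an unbounded set of naturals;
this rules that out. -/
theorem IsPair.bddAbove_reflTime (hP : IsPair Θ₁ Θ₂ A B r D R) (hq : Leaves A q) (hq0 : q.2 ≠ 0)
    (t : ℝ) : BddAbove {i : ℕ | reflTime Θ₁ Θ₂ q i ≤ ENNReal.ofReal t} := by
  have hv := norm_pos_iff.2 hq0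
  have hg := hP.gap_pos
  obtain ⟨N, hN⟩ := exists_nat_gt (max t 0 / (D / ‖q.2‖))
  refine ⟨N, fun i hi => ?_⟩
  have h1 := (hP.le_reflTime hq hq0 i).trans (hi.trans (ENNReal.ofReal_le_ofReal (le_max_left t 0)))
  rw [ENNReal.ofReal_le_ofReal_iff (le_max_right _ _), ← le_div_iff₀ (by positivity)] at h1
  exact_mod_cast (h1.trans_lt hN).le

theorem reflTime_zero (q : Phase) : reflTime Θ₁ Θ₂ q 0 = 0 := by simp [reflTime]

theorem flow_eq_free (hq : IsTame (Θ₁ ∪ Θ₂) q)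
    (ht : ∀ s, 0 < s → s ≤ t → (free s q).1 ∉ Θ₁ ∪ Θ₂) : flow Θ₁ Θ₂ t q = free t q := by
  have hlt : ENNReal.ofReal t < firstHit (Θ₁ ∪ Θ₂) q := by
    rcases hq with h1 | ⟨h, hh⟩
    · rw [firstHit_eq_top h1]; exact ENNReal.ofReal_lt_top
    · rw [hh.firstHit_eq, ENNReal.ofReal_lt_ofReal_iff hh.pos]
      by_contra! hle
      exact ht h hh.pos hle hh.mem
  have hN : numRefl Θ₁ Θ₂ q t = 0 := by
    refine IsGreatest.csSup_eq ⟨by simp [reflTime_zero], fun i hi => ?_⟩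
    cases i with
    | zero => exact le_rfl
    | succ i =>
      change reflTime Θ₁ Θ₂ q _ ≤ _ at hi
      rw [reflTime_succ] at hi
      exact absurd (le_self_add.trans hi) (not_le.2 hlt)
  simp only [flow, hN, reflState, Function.iterate_zero, id_eq, reflTime_zero,
    ENNReal.toReal_zero, sub_zero, free]

/-- The reflections up to time `t` are the first one and those of the reflected state up to `t - h`.
Together with `flow_eq_free`, this recursion replaces the definition of the flow from here on. -/
theorem IsPair.flow_eq_flow_bounceAt (hP : IsPair Θ₁ Θ₂ A B r D R)
    (hh : IsFirstHit (Θ₁ ∪ Θ₂) q h) (hq0 : q.2 ≠ 0) (ht : h ≤ t) :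
    flow Θ₁ Θ₂ t q = flow Θ₁ Θ₂ (t - h) (bounceAt Θ₁ Θ₂ h q) := by
  wlog hy : (free h q).1 ∈ B generalizing A B with H
  · exact H hP.symm (((hP.union_eq ▸ hh.mem : _ ∈ A ∪ B)).resolve_right hy)
  have hhB : IsFirstHit B q h := hh.subset (hP.union_eq ▸ Set.subset_union_right) hy
  have hv := norm_pos_iff.2 hq0
  rw [← hh.bounce_eq]
  set b := bounce Θ₁ Θ₂ q with hb
  have hbdd := hP.symm.bddAbove_reflTime (hP.leaves_bounceAt hhB hq0)
    (by rw [← norm_pos_iff, hP.norm_bounceAt hhB]; exact hv) (t - h)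
  rw [← hh.bounce_eq, ← hb] at hbdd
  have hmem : reflTime Θ₁ Θ₂ b (numRefl Θ₁ Θ₂ b (t - h)) ≤ ENNReal.ofReal (t - h) :=
    Nat.sSup_mem ⟨0, by simp [reflTime_zero]⟩ hbdd
  have hiff : ∀ x : ℝ≥0∞, ENNReal.ofReal h + x ≤ ENNReal.ofReal t ↔ x ≤ ENNReal.ofReal (t - h) := by
    intro x
    rw [show t = h + (t - h) by ring, ENNReal.ofReal_add hh.pos.le (by linarith),
      add_sub_cancel_left, ENNReal.add_le_add_iff_left ENNReal.ofReal_ne_top]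
  have hN : numRefl Θ₁ Θ₂ q t = numRefl Θ₁ Θ₂ b (t - h) + 1 := by
    refine IsGreatest.csSup_eq ⟨?_, fun i hi => ?_⟩
    · change reflTime Θ₁ Θ₂ q _ ≤ _
      rw [reflTime_succ, hh.firstHit_eq, hiff]
      exact hmem
    · cases i with
      | zero => omega
      | succ i =>
        change reflTime Θ₁ Θ₂ q _ ≤ _ at hi
        rw [reflTime_succ, hh.firstHit_eq, hiff] at hi
        have := le_csSup hbdd hi
        exact Nat.succ_le_succ this
  have hT : (reflTime Θ₁ Θ₂ q (numRefl Θ₁ Θ₂ b (t - h) + 1)).toReal =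
      h + (reflTime Θ₁ Θ₂ b (numRefl Θ₁ Θ₂ b (t - h))).toReal := by
    rw [reflTime_succ, hh.firstHit_eq, ENNReal.toReal_add ENNReal.ofReal_ne_top
      (ne_top_of_le_ne_top ENNReal.ofReal_ne_top hmem), ENNReal.toReal_ofReal hh.pos.le]
  simp only [flow, hN, hT, reflState, Function.iterate_succ_apply, ← hb, sub_sub]

/-- The flow commutes with free motion before the first hit. -/
theorem IsPair.flow_add (hP : IsPair Θ₁ Θ₂ A B r D R) (hq : IsTame (Θ₁ ∪ Θ₂) q) (hq0 : q.2 ≠ 0)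
    (hv : 0 ≤ v) (hfree : ∀ s, 0 < s → s ≤ v → (free s q).1 ∉ Θ₁ ∪ Θ₂) :
    flow Θ₁ Θ₂ (v + u) q = flow Θ₁ Θ₂ u (free v q) := by
  rcases hq with h1 | ⟨h, hh⟩
  · rw [flow_eq_free (.inl h1) fun s hs _ => h1 s hs]
    have h2 : ∀ s, 0 < s → (free s (free v q)).1 ∉ Θ₁ ∪ Θ₂ := fun s hs => by
      rw [free_free]; exact h1 _ (by linarith)
    rw [flow_eq_free (.inl h2) fun s hs _ => h2 s hs, free_free]
  · have hvh : v < h := by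
      by_contra! hle
      exact hfree h hh.pos hle hh.mem
    have hh2 := hh.free hv hvh
    by_cases hlt : v + u < h
    · rw [flow_eq_free (.inr ⟨h, hh⟩) fun s hs hsu => hh.before s hs (by linarith),
        flow_eq_free (.inr ⟨_, hh2⟩) fun s hs hsu => hh2.before s hs (by linarith), free_free]
    · rw [hP.flow_eq_flow_bounceAt hh hq0 (by linarith),
        hP.flow_eq_flow_bounceAt hh2 (by simpa) (by linarith), bounceAt_free]
      congr 1
      ring

/-- Motion at constant speed `‖q.2‖`. -/
theorem IsPair.flow_bound_of_leaves (hP : IsPair Θ₁ Θ₂ A B r D R) (hq : Leaves A q)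
    (hq0 : q.2 ≠ 0) (k : ℕ) (ht : 0 ≤ t) (hk : t * ‖q.2‖ ≤ k * D) :
    ‖(flow Θ₁ Θ₂ t q).1 - q.1‖ ≤ t * ‖q.2‖ ∧ ‖(flow Θ₁ Θ₂ t q).2‖ = ‖q.2‖ := by
  have hv := norm_pos_iff.2 hq0
  have hD := hP.gap_pos
  induction k generalizing A B q t with
  | zero =>
    have ht0 : t = 0 := by
      simp only [Nat.cast_zero, zero_mul] at hk
      nlinarith
    subst ht0
    rw [flow_eq_free (hP.isTame_of_leaves hq.2 (hP.disjoint hq.1)) fun s hs hs' => by linarith]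
    simp
  | succ k ih =>
    have htame := hP.isTame_of_leaves hq.2 (hP.disjoint hq.1)
    by_cases hfree : ∀ s, 0 < s → s ≤ t → (free s q).1 ∉ Θ₁ ∪ Θ₂
    · rw [flow_eq_free htame hfree]
      simp [free_fst, norm_smul, abs_of_nonneg ht]
    · push Not at hfree
      obtain ⟨s, hs, hst, hsO⟩ := hfree
      rcases htame with h1 | ⟨h, hh⟩
      · exact absurd hsO (h1 s hs)
      · have hle : h ≤ t := by
          by_contra! hlt
          exact hh.before s hs (by linarith) hsO
        have hhB := (hP.isFirstHit_iff_of_leaves hq.2).1 hh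
        have hn := hP.norm_bounceAt hhB
        have hgap := hP.gap_le hq.1 hhB
        rw [hP.flow_eq_flow_bounceAt hh hq0 hle]
        obtain ⟨h3, h4⟩ := ih (t := t - h) hP.symm (hP.leaves_bounceAt hhB hq0)
          (by rw [← norm_pos_iff, hn]; exact hv) (by linarith)
          (by rw [hn]; push_cast at hk; nlinarith) (by rwa [hn])
        rw [hn] at h3 h4
        refine ⟨?_, h4⟩
        have h5 : ‖(bounceAt Θ₁ Θ₂ h q).1 - q.1‖ = h * ‖q.2‖ := by
          simp [bounceAt, free_fst, norm_smul, abs_of_pos hh.pos]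
        calc _ ≤ _ := norm_sub_le_norm_sub_add_norm_sub _ (bounceAt Θ₁ Θ₂ h q).1 _
          _ ≤ (t - h) * ‖q.2‖ + h * ‖q.2‖ := by rw [h5]; gcongr
          _ = _ := by ring

theorem IsPair.flow_bound (hP : IsPair Θ₁ Θ₂ A B r D R) (hq : IsTame (Θ₁ ∪ Θ₂) q)
    (hq0 : q.2 ≠ 0) (ht : 0 ≤ t) :
    ‖(flow Θ₁ Θ₂ t q).1 - q.1‖ ≤ t * ‖q.2‖ ∧ ‖(flow Θ₁ Θ₂ t q).2‖ = ‖q.2‖ := by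
  have hv := norm_pos_iff.2 hq0
  by_cases hfree : ∀ s, 0 < s → s ≤ t → (free s q).1 ∉ Θ₁ ∪ Θ₂
  · rw [flow_eq_free hq hfree]
    simp [free_fst, norm_smul, abs_of_nonneg ht]
  · push Not at hfree
    obtain ⟨s, hs, hst, hsO⟩ := hfree
    rcases hq with h1 | ⟨h, hh⟩
    · exact absurd hsO (h1 s hs)
    · wlog hy : (free h q).1 ∈ B generalizing A B with H
      · exact H hP.symm (((hP.union_eq ▸ hh.mem : _ ∈ A ∪ B)).resolve_right hy)
      have hhB : IsFirstHit B q h := hh.subset (hP.union_eq ▸ Set.subset_union_right) hy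
      have hle : h ≤ t := by
        by_contra! hlt
        exact hh.before s hs (by linarith) hsO
      have hn := hP.norm_bounceAt hhB
      rw [hP.flow_eq_flow_bounceAt hh hq0 hle]
      obtain ⟨k, hk⟩ := exists_nat_ge ((t - h) * ‖q.2‖ / D)
      rw [div_le_iff₀ hP.gap_pos] at hk
      obtain ⟨h3, h4⟩ := hP.symm.flow_bound_of_leaves (t := t - h) (hP.leaves_bounceAt hhB hq0)
        (by rw [← norm_pos_iff, hn]; exact hv) k (by linarith) (by rwa [hn])
      rw [hn] at h3 h4
      refine ⟨?_, h4⟩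
      have h5 : ‖(bounceAt Θ₁ Θ₂ h q).1 - q.1‖ = h * ‖q.2‖ := by
        simp [bounceAt, free_fst, norm_smul, abs_of_pos hh.pos]
      calc _ ≤ _ := norm_sub_le_norm_sub_add_norm_sub _ (bounceAt Θ₁ Θ₂ h q).1 _
        _ ≤ (t - h) * ‖q.2‖ + h * ‖q.2‖ := by rw [h5]; gcongr
        _ = _ := by ring

end

/-! ### Nearby rays at a single obstacle -/

theorem dist_free_le {q q' : Phase} {s d H : ℝ} (hs : 0 ≤ s) (hsH : s ≤ H) (hd : dist q q' ≤ d) :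
    ‖(free s q).1 - (free s q').1‖ ≤ (1 + H) * d := by
  rw [Prod.dist_eq, max_le_iff, dist_eq_norm, dist_eq_norm] at hd
  have h1 : (free s q).1 - (free s q').1 = (q.1 - q'.1) + s • (q.2 - q'.2) := by
    simp only [free_fst]; module
  rw [h1]
  refine (norm_add_le _ _).trans ?_
  rw [norm_smul, Real.norm_of_nonneg hs]
  have := norm_nonneg (q.2 - q'.2)
  nlinarith

/-- The points close to a convex set form a convex set. -/
theorem exists_dist_free_le {Θ : Set E3} (hΘ : Convex ℝ Θ) {p : Phase} {a b s e : ℝ} {y z : E3}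
    (hy : y ∈ Θ) (hz : z ∈ Θ) (hay : dist (free a p).1 y ≤ e) (hbz : dist (free b p).1 z ≤ e)
    (has : a ≤ s) (hsb : s ≤ b) : ∃ w ∈ Θ, dist (free s p).1 w ≤ e := by
  rcases (has.trans hsb).eq_or_lt with rfl | hab
  · exact ⟨y, hy, by rwa [le_antisymm hsb has]⟩
  · have hba : 0 < b - a := by linarith
    have h1 : 0 ≤ (s - a) / (b - a) := div_nonneg (by linarith) hba.le
    have h2 : 0 ≤ (b - s) / (b - a) := div_nonneg (by linarith) hba.le
    have h3 : (b - s) / (b - a) + (s - a) / (b - a) = 1 := by field_simp; ring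
    refine ⟨_, hΘ hy hz h2 h1 h3, ?_⟩
    rw [dist_eq_norm] at hay hbz ⊢
    have hs : s = (b - s) / (b - a) * a + (s - a) / (b - a) * b := by field_simp; ring
    have h4 : (free s p).1 = ((b - s) / (b - a)) • (free a p).1 + ((s - a) / (b - a)) • (free b p).1 := by
      simp only [free_fst]
      rw [smul_add, smul_add, smul_smul, smul_smul]
      nth_rewrite 1 [hs]
      nth_rewrite 1 [← one_smul ℝ p.1]
      rw [← h3]
      module
    set l := (b - s) / (b - a)
    set m := (s - a) / (b - a)
    have h5 : (free s p).1 - (l • y + m • z) = l • ((free a p).1 - y) + m • ((free b p).1 - z) := by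
      rw [h4]; module
    rw [h5]
    refine (norm_add_le _ _).trans ?_
    rw [norm_smul, norm_smul, Real.norm_of_nonneg h1, Real.norm_of_nonneg h2]
    calc _ ≤ l * e + m * e := by gcongr
      _ = e := by rw [← add_mul, h3, one_mul]

/-- A ray entering a round set at the normal speed `-⟪n y, ξ⟫` is deep inside it soon after. -/
theorem IsRound.depth {Θ : Set E3} {n : E3 → E3} {r : ℝ} (hΘ : IsRound Θ n r) {y ξ w : E3}
    (hy : y ∈ frontier Θ) {v : ℝ} (hv : 0 ≤ v) (hvr : v * ‖ξ‖ ^ 2 ≤ r * -⟪n y, ξ⟫)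
    (hw : w ∉ interior Θ) : v * -⟪n y, ξ⟫ ≤ 2 * ‖y + v • ξ - w‖ := by
  have hn := hΘ.norm_normal y hy
  have hr := hΘ.pos
  set c := -⟪n y, ξ⟫ with hc
  have hcξ : c ≤ ‖ξ‖ := by
    have := abs_real_inner_le_norm (n y) ξ
    rw [hn, one_mul] at this
    exact (neg_le_abs _).trans this
  by_contra! hlt
  have hc0 : 0 < c := by
    by_contra! hc0
    have := norm_nonneg (y + v • ξ - w)
    nlinarith
  have hvc : v * c ≤ r := by
    have h1 : v * c * c ≤ v * ‖ξ‖ ^ 2 := by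
      rw [mul_assoc, ← sq]; gcongr
    exact le_of_mul_le_mul_right (h1.trans hvr) hc0
  -- In squares: `v² ‖ξ‖² - 2 r v c + r² ≤ r² - r v c ≤ (r - v c / 2)²`.
  have h1 : ‖y + v • ξ - (y - r • n y)‖ ≤ r - v * c / 2 := by
    have h2 : y + v • ξ - (y - r • n y) = v • ξ + r • n y := by abel
    refine abs_le_of_sq_le_sq' ?_ (by linarith) |>.2
    rw [h2, norm_add_sq_real, norm_smul, norm_smul, hn, Real.norm_of_nonneg hr.le,
      Real.norm_of_nonneg hv, inner_smul_left, inner_smul_right, real_inner_comm]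
    simp only [conj_trivial]
    rw [show ⟪n y, ξ⟫ = -c by rw [hc]; ring]
    nlinarith [sq_nonneg (v * c)]
  have h3 : w ∈ Metric.ball (y - r • n y) r := by
    rw [Metric.mem_ball, dist_eq_norm]
    calc ‖w - (y - r • n y)‖ ≤ ‖w - (y + v • ξ)‖ + ‖y + v • ξ - (y - r • n y)‖ :=
          norm_sub_le_norm_sub_add_norm_sub _ _ _
      _ < v * c / 2 + (r - v * c / 2) := by
          rw [norm_sub_rev w]; linarith
      _ = r := by ring
  exact hw (interior_maximal (Metric.ball_subset_closedBall.trans (hΘ.ball y hy))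
    Metric.isOpen_ball h3)

/-- If a ray hits a round set, a ray nearby that stays out of it during the time `w` after the hit
allows only a grazing hit, or `w` is small. -/
theorem IsRound.entry_alternative {Θ : Set E3} {n : E3 → E3} {r : ℝ} (hΘ : IsRound Θ n r)
    {q q' : Phase} {h w e : ℝ} (hy : (free h q).1 ∈ frontier Θ) (hq0 : q.2 ≠ 0) (hw : 0 ≤ w)
    (hc : ⟪n (free h q).1, q.2⟫ ≤ 0)
    (hout : ∀ v, 0 ≤ v → v ≤ w → (free (h + v) q').1 ∉ interior Θ)
    (he : ∀ v, 0 ≤ v → v ≤ w → ‖(free (h + v) q).1 - (free (h + v) q').1‖ ≤ e) :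
    w * -⟪n (free h q).1, q.2⟫ ≤ 2 * e ∨
      r * (-⟪n (free h q).1, q.2⟫) ^ 2 ≤ 2 * e * ‖q.2‖ ^ 2 := by
  have hr := hΘ.pos
  have hv := norm_pos_iff.2 hq0
  set c := -⟪n (free h q).1, q.2⟫ with hcdef
  have hc0 : 0 ≤ c := by linarith
  have key : ∀ v, 0 ≤ v → v ≤ w → v * ‖q.2‖ ^ 2 ≤ r * c → v * c ≤ 2 * e := by
    intro v hv0 hvw hvr
    have h1 := hΘ.depth hy hv0 hvr (hout v hv0 hvw)
    have h2 := he v hv0 hvw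
    have h3 : (free h q).1 + v • q.2 = (free (h + v) q).1 := by
      simp only [free_fst]; module
    rw [h3] at h1
    linarith
  -- The depth estimate holds up to time `r * c / ‖q.2‖ ^ 2`. If `w` is larger, the estimate at that
  -- time gives the quadratic alternative.
  by_cases hwr : w * ‖q.2‖ ^ 2 ≤ r * c
  · exact .inl (key w hw le_rfl hwr)
  · right
    push Not at hwr
    have h1 := key (r * c / ‖q.2‖ ^ 2) (by positivity)
      (by rw [div_le_iff₀ (by positivity)]; exact hwr.le)
      (by rw [div_mul_cancel₀ _ (by positivity)])
    rw [div_mul_eq_mul_div, div_le_iff₀ (by positivity)] at h1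
    linarith

/-- For hits at nearby points, where the normals are close. -/
theorem norm_reflection_sub_le {m m' ξ ξ' : E3} (hm : ‖m‖ = 1) (hm' : ‖m'‖ = 1) :
    ‖(ξ - (2 * ⟪m, ξ⟫) • m) - (ξ' - (2 * ⟪m', ξ'⟫) • m')‖ ≤
      3 * ‖ξ - ξ'‖ + 4 * ‖ξ'‖ * ‖m - m'‖ := by
  have h1 : (ξ - (2 * ⟪m, ξ⟫) • m) - (ξ' - (2 * ⟪m', ξ'⟫) • m') =
      (ξ - ξ') - (2 * ⟪m, ξ - ξ'⟫) • m - (2 * ⟪m - m', ξ'⟫) • m - (2 * ⟪m', ξ'⟫) • (m - m') := by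
    simp only [inner_sub_left, inner_sub_right]; module
  have h2 := abs_real_inner_le_norm m (ξ - ξ')
  have h3 := abs_real_inner_le_norm (m - m') ξ'
  have h4 := abs_real_inner_le_norm m' ξ'
  rw [hm, one_mul] at h2
  rw [hm', one_mul] at h4
  rw [h1]
  refine (norm_sub_le _ _).trans ?_
  refine (add_le_add_left ((norm_sub_le _ _).trans (add_le_add_left (norm_sub_le _ _) _)) _).trans ?_
  rw [norm_smul, norm_smul, norm_smul, hm, Real.norm_eq_abs, Real.norm_eq_abs, Real.norm_eq_abs,
    abs_mul, abs_mul, abs_mul, abs_two]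
  have := norm_nonneg (m - m')
  nlinarith

/-- For nearly tangential hits: each velocity hardly changes, however far apart the normals are. -/
theorem norm_reflection_sub_le' {m m' ξ ξ' : E3} (hm : ‖m‖ = 1) (hm' : ‖m'‖ = 1) :
    ‖(ξ - (2 * ⟪m, ξ⟫) • m) - (ξ' - (2 * ⟪m', ξ'⟫) • m')‖ ≤
      ‖ξ - ξ'‖ + 2 * |⟪m, ξ⟫| + 2 * |⟪m', ξ'⟫| := by
  have h1 : (ξ - (2 * ⟪m, ξ⟫) • m) - (ξ' - (2 * ⟪m', ξ'⟫) • m') =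
      (ξ - ξ') - (2 * ⟪m, ξ⟫) • m + (2 * ⟪m', ξ'⟫) • m' := by abel
  rw [h1]
  refine (norm_add_le _ _).trans ((add_le_add_left (norm_sub_le _ _) _).trans ?_)
  rw [norm_smul, norm_smul, hm, hm', Real.norm_eq_abs, Real.norm_eq_abs, abs_mul, abs_mul, abs_two]
  linarith

/-- The source of the square root. Here `c`, `c'` are the normal speeds of two hits separated by the
time `Δ`, and the rays are at distance of order `s ^ 2`. A normal speed above the threshold `s`
forces `Δ` to be of order `s`, unless the quadratic alternative makes `c` itself of order `s`;
otherwise both hits are grazing. -/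
theorem grazing_holder {E s H β r Δ c c' : ℝ} (hE : 1 ≤ E) (hs : 0 ≤ s) (hs1 : s ≤ 1)
    (hr : 0 < r) (hΔ : 0 ≤ Δ) (hΔH : Δ ≤ H) (hc : 0 ≤ c)
    (h1 : Δ * c' ≤ E * s ^ 2) (h2 : Δ * c ≤ 2 * (E * s ^ 2) ∨ r * c ^ 2 ≤ 2 * (E * s ^ 2) * β ^ 2) :
    let K := 2 * E + (1 + H) * √(2 * E * β ^ 2 / r)
    Δ * c ≤ K * s ∧ (Δ ≤ K * s ∨ (c ≤ K * s ∧ c' ≤ K * s)) := by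
  intro K
  set k := √(2 * E * β ^ 2 / r) with hk
  have hk0 : 0 ≤ k := Real.sqrt_nonneg _
  have hH : 0 ≤ H := hΔ.trans hΔH
  have hHk : 0 ≤ H * k := mul_nonneg hH hk0
  have hK1 : 2 * E ≤ K := by change _ ≤ 2 * E + (1 + H) * k; nlinarith
  have hK2 : k ≤ K := by change _ ≤ 2 * E + (1 + H) * k; nlinarith
  have hK3 : H * k ≤ K := by change _ ≤ 2 * E + (1 + H) * k; nlinarith
  have hEs : 2 * (E * s ^ 2) ≤ 2 * E * s := by
    have h3 : s ^ 2 ≤ s := by nlinarith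
    have h4 : E * s ^ 2 ≤ E * s := by gcongr
    linarith
  have hc2 : r * c ^ 2 ≤ 2 * (E * s ^ 2) * β ^ 2 → c ≤ k * s := fun h => by
    refine abs_le_of_sq_le_sq' ?_ (by positivity) |>.2
    rw [mul_pow, hk, Real.sq_sqrt (by positivity), div_mul_eq_mul_div, le_div_iff₀ hr]
    linarith
  have hK1s : 2 * E * s ≤ K * s := by gcongr
  have hK2s : k * s ≤ K * s := by gcongr
  have hsK : s ≤ K * s := le_mul_of_one_le_left hs (by linarith)
  have hlarge : ∀ a, s < a → Δ * a ≤ 2 * (E * s ^ 2) → Δ ≤ 2 * E * s := fun a ha h => by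
    rcases hs.eq_or_lt with h0 | h0
    · rw [← h0] at h ha ⊢
      nlinarith
    · have h3 : Δ * s ≤ Δ * a := by gcongr
      refine le_of_mul_le_mul_right ?_ h0
      linarith
  refine ⟨?_, ?_⟩
  · rcases h2 with h2 | h2
    · linarith
    · calc Δ * c ≤ H * (k * s) := by have := hc2 h2; gcongr
        _ = H * k * s := by ring
        _ ≤ K * s := by gcongr
  · by_cases hc' : c' ≤ s
    · rcases h2 with h2 | h2
      · by_cases hcs : c ≤ s
        · exact .inr ⟨hcs.trans hsK, hc'.trans hsK⟩
        · exact .inl ((hlarge c (not_le.1 hcs) h2).trans hK1s)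
      · exact .inr ⟨(hc2 h2).trans hK2s, hc'.trans hsK⟩
    · refine .inl ((hlarge c' (not_le.1 hc') ?_).trans hK1s)
      nlinarith [sq_nonneg s]

/-- If one of the two hits has normal speed at least `δ`, dividing by it bounds the time between
them linearly in `e`. -/
theorem transversal_lipschitz {e H β r Δ c c' δ : ℝ} (he : 0 ≤ e) (hr : 0 < r) (hΔ : 0 ≤ Δ)
    (hΔH : Δ ≤ H) (hδ : 0 < δ) (h1 : Δ * c' ≤ e)
    (h2 : Δ * c ≤ 2 * e ∨ r * c ^ 2 ≤ 2 * e * β ^ 2) (h3 : δ ≤ c ∨ δ ≤ c') :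
    Δ ≤ (2 / δ + 2 * H * β ^ 2 / (r * δ ^ 2)) * e := by
  have hH : 0 ≤ H := hΔ.trans hΔH
  have h4 : ∀ a, δ ≤ a → Δ * a ≤ 2 * e → Δ ≤ 2 / δ * e := fun a ha h => by
    rw [div_mul_eq_mul_div, le_div_iff₀ hδ]
    exact (mul_le_mul_of_nonneg_left ha hΔ).trans h
  have h5 : 0 ≤ 2 * H * β ^ 2 / (r * δ ^ 2) * e := by positivity
  have h6 : 0 ≤ 2 / δ * e := by positivity
  rw [add_mul]
  rcases h3 with h3 | h3
  · rcases h2 with h2 | h2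
    · linarith [h4 c h3 h2]
    · have h7 : r * δ ^ 2 ≤ 2 * e * β ^ 2 := le_trans (by gcongr) h2
      -- Here the quadratic alternative bounds `e` from below, so the trivial bound `Δ ≤ H`
      -- suffices.
      have h8 : H ≤ 2 * H * β ^ 2 / (r * δ ^ 2) * e := by
        rw [div_mul_eq_mul_div, le_div_iff₀ (by positivity)]
        nlinarith
      linarith
  · linarith [h4 c' h3 (by linarith)]

theorem free_bounceAt_fst {Θ₁ Θ₂ : Set E3} {h u : ℝ} {q : Phase} :
    (free u (bounceAt Θ₁ Θ₂ h q)).1 = (free (h + u) q).1 +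
      (2 * (u * -⟪normalAt Θ₁ Θ₂ (free h q).1, q.2⟫)) • normalAt Θ₁ Θ₂ (free h q).1 := by
  simp only [bounceAt, free_fst]
  module

set_option maxHeartbeats 800000 in
/-- Comparison of two nearby rays reflected by the same obstacle. -/
theorem exists_reflection_close {r α β H δ : ℝ} (hr : 0 < r) (hα : 0 < α) (hH : 0 ≤ H)
    (hδ : 0 < δ) : ∃ C : ℝ, 1 ≤ C ∧ ∀ Θ₁ Θ₂ Θ : Set E3, IsRound Θ (normalAt Θ₁ Θ₂) r →
      ∀ q q' : Phase, ∀ h h' d : ℝ, ‖q.2‖ ∈ Set.Icc α β → ‖q'.2‖ ∈ Set.Icc α β →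
      IsFirstHit Θ q h → IsFirstHit Θ q' h' → h ≤ h' → h' ≤ H → dist q q' ≤ d → d ≤ 1 →
      dist (free (h' - h) (bounceAt Θ₁ Θ₂ h q)) (bounceAt Θ₁ Θ₂ h' q') ≤ C * √d ∧
      (∀ u, 0 ≤ u → u ≤ h' - h →
        ∃ z ∈ Θ, dist (free u (bounceAt Θ₁ Θ₂ h q)).1 z ≤ C * √d) ∧
      (δ ≤ -⟪normalAt Θ₁ Θ₂ (free h q).1, q.2⟫ ∨ δ ≤ -⟪normalAt Θ₁ Θ₂ (free h' q').1, q'.2⟫ →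
        dist (free (h' - h) (bounceAt Θ₁ Θ₂ h q)) (bounceAt Θ₁ Θ₂ h' q') ≤ C * d) := by
  set E := 1 + H with hE
  set K := 2 * E + (1 + H) * √(2 * E * β ^ 2 / r) with hK
  set M := 2 / δ + 2 * H * β ^ 2 / (r * δ ^ 2) with hM
  have hK0 : 0 ≤ K := by positivity
  have hM0 : 0 ≤ M := by positivity
  have hE1 : 1 ≤ E := by linarith
  set C := (2 * E + 2 * K) + (3 + 4 * |β| / r * (E + |β| * K) + 4 * K) +
    ((E + 2 * |β| * (M * E)) + (3 + 4 * |β| / r * (E + |β| * (M * E)))) with hC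
  have hA1 : 0 ≤ 4 * |β| / r * (E + |β| * K) := by positivity
  have hA2 : 0 ≤ |β| * (M * E) := by positivity
  have hA3 : 0 ≤ 4 * |β| / r * (E + |β| * (M * E)) := by positivity
  refine ⟨C, by linarith, ?_⟩
  intro Θ₁ Θ₂ Θ hΘ q q' h h' d hq hq' hh hh' hle hh'H hd hd1
  set n := normalAt Θ₁ Θ₂ with hn
  have hβ : 0 ≤ β := hα.le.trans (hq.1.trans hq.2)
  rw [abs_of_nonneg hβ] at hC hA1 hA2 hA3
  have hd0 : 0 ≤ d := dist_nonneg.trans hd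
  have hq0 : q.2 ≠ 0 := norm_pos_iff.1 (hα.trans_le hq.1)
  set s := √d with hs
  have hs0 : 0 ≤ s := Real.sqrt_nonneg d
  have hs2 : s ^ 2 = d := Real.sq_sqrt hd0
  have hs1 : s ≤ 1 := Real.sqrt_le_one.2 hd1
  have hds : d ≤ s := by nlinarith
  have hy := hh.mem_frontier hΘ.isClosed
  have hy' := hh'.mem_frontier hΘ.isClosed
  have hcn := hh.inner_nonpos hΘ
  have hcn' := hh'.inner_nonpos hΘ
  have hm := hΘ.norm_normal _ hy
  have hm' := hΘ.norm_normal _ hy'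
  have hclose : ∀ t, 0 ≤ t → t ≤ H → ‖(free t q).1 - (free t q').1‖ ≤ E * d := fun t ht htH =>
    dist_free_le ht htH hd
  have hlip := hΘ.norm_normal_sub_le hy hy'
  set y := (free h q).1 with hydef
  set y' := (free h' q').1 with hydef'
  set c := -⟪n y, q.2⟫ with hc
  set c' := -⟪n y', q'.2⟫ with hc'
  set Δ := h' - h with hΔ
  have hc0 : 0 ≤ c := by linarith
  have hc0' : 0 ≤ c' := by linarith
  have hΔ0 : 0 ≤ Δ := by linarith
  have hpos := hh.pos
  have hcβ : c ≤ β := by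
    have := abs_real_inner_le_norm (n y) q.2
    rw [hm, one_mul] at this
    exact (neg_le_abs _).trans (this.trans hq.2)
  -- `Δ * c'` is the height of the second ray at time `h` above the tangent plane at `y'`; it is
  -- then within `E * d` of `y`, which lies behind that plane.
  have h1 : Δ * c' ≤ E * d := by
    have h2 := hΘ.support y' hy' y hh.mem
    have h3 : Δ * c' = ⟪n y', (free h q').1 - y⟫ + ⟪n y', y - y'⟫ := by
      have h4 : (free h q').1 - y' = -(Δ • q'.2) := by
        simp only [hydef', free_fst, hΔ]; module
      rw [← inner_add_right, sub_add_sub_cancel, h4, inner_neg_right, inner_smul_right, hc']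
      ring
    have h4 : ⟪n y', (free h q').1 - y⟫ ≤ E * d := by
      refine (real_inner_le_norm _ _).trans ?_
      rw [hm', one_mul, norm_sub_rev]
      exact hclose h hpos.le (by linarith)
    linarith
  -- The second ray stays out of the interior until `h'`, so the straight continuation of the first
  -- cannot go deep.
  have h2 : Δ * c ≤ 2 * (E * d) ∨ r * c ^ 2 ≤ 2 * (E * d) * β ^ 2 := by
    refine (hΘ.entry_alternative (q' := q') (w := Δ) (e := E * d) hy hq0 hΔ0 hcn
      (fun v hv hvΔ => ?_) fun v hv hvΔ => hclose _ (by linarith) (by linarith)).imp_right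
      fun h3 => h3.trans ?_
    · rcases hvΔ.eq_or_lt with rfl | hlt
      · rw [show h + Δ = h' by rw [hΔ]; ring]
        exact hy'.2
      · exact fun hint => hh'.before (h + v) (by linarith) (by linarith) (interior_subset hint)
    · gcongr; exact hq.2
  have hyy : ‖y - y'‖ ≤ E * d + β * Δ := by
    have h3 : y - y' = ((free h' q).1 - y') - Δ • q.2 := by
      simp only [hydef, free_fst, hΔ]; module
    rw [h3]
    refine (norm_sub_le _ _).trans ?_
    rw [norm_smul, Real.norm_of_nonneg hΔ0, mul_comm β]
    exact add_le_add (hclose h' (by linarith) hh'H) (by gcongr; exact hq.2)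
  have hvel2 : dist q.2 q'.2 ≤ d := (le_max_right _ _).trans hd
  rw [dist_eq_norm] at hvel2
  have hpos2 : dist (free Δ (bounceAt Θ₁ Θ₂ h q)).1 (bounceAt Θ₁ Θ₂ h' q').1 ≤
      E * d + 2 * (Δ * c) := by
    rw [free_bounceAt_fst, dist_eq_norm, show h + Δ = h' by rw [hΔ]; ring, add_sub_right_comm]
    refine (norm_add_le _ _).trans (add_le_add (hclose h' (by linarith) hh'H) ?_)
    rw [norm_smul, hm, mul_one, Real.norm_of_nonneg (by positivity)]
  have hvel : dist (bounceAt Θ₁ Θ₂ h q).2 (bounceAt Θ₁ Θ₂ h' q').2 ≤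
      3 * d + 4 * β / r * (E * d + β * Δ) := by
    rw [dist_eq_norm]
    refine (norm_reflection_sub_le hm hm').trans ?_
    have h3 : ‖n y - n y'‖ ≤ (E * d + β * Δ) / r := by
      rw [le_div_iff₀ hr, mul_comm]; exact hlip.trans hyy
    calc _ ≤ 3 * d + 4 * β * ((E * d + β * Δ) / r) := by gcongr; exact hq'.2
      _ = _ := by ring
  have hvel' : dist (bounceAt Θ₁ Θ₂ h q).2 (bounceAt Θ₁ Θ₂ h' q').2 ≤ d + 2 * c + 2 * c' := by
    rw [dist_eq_norm]
    refine (norm_reflection_sub_le' hm hm').trans ?_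
    rw [abs_of_nonpos hcn, abs_of_nonpos hcn']
    linarith
  have h2' := h2
  rw [← hs2] at h2'
  obtain ⟨hg1, hg2⟩ := grazing_holder (H := H) (c' := c') hE1 hs0 hs1 hr hΔ0 (by linarith) hc0
    (by rw [hs2]; exact h1) h2'
  have hEd : E * d ≤ E * s := by gcongr
  have hbase : ∀ X Y : ℝ, 0 ≤ X → Y ≤ C → X ≤ Y * s → X ≤ C * s := fun X Y _ hY hX =>
    hX.trans (by gcongr)
  have hPs : E * d + 2 * (Δ * c) ≤ (E + 2 * K) * s := by
    have : Δ * c ≤ K * s := hg1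
    linarith
  refine ⟨?_, fun u hu huΔ => ?_, fun hδc => ?_⟩
  · rw [Prod.dist_eq, max_le_iff]
    refine ⟨hbase _ _ dist_nonneg (by linarith) (hpos2.trans hPs), ?_⟩
    -- Either the hits are close, and so are the normals, or both are grazing and the velocities
    -- hardly change.
    rcases hg2 with h3 | ⟨h3, h4⟩
    · refine hbase _ (3 + 4 * β / r * (E + β * K)) dist_nonneg (by linarith) (hvel.trans ?_)
      have h3 : Δ ≤ K * s := h3
      calc _ ≤ 3 * s + 4 * β / r * (E * s + β * (K * s)) := by gcongr
        _ = _ := by ring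
    · refine hbase _ (1 + 4 * K) dist_nonneg (by linarith) (hvel'.trans ?_)
      have h3 : c ≤ K * s := h3
      have h4 : c' ≤ K * s := h4
      linarith
  -- Between the two hits the second ray stays near `Θ` by convexity, and reflection displaces the
  -- first from its straight continuation by at most `2 * (Δ * c)`.
  · obtain ⟨z, hz, hzd⟩ := exists_dist_free_le (p := q') (a := h) (b := h') (s := h + u)
      (e := E * d) hΘ.convex hh.mem hh'.mem
      (by rw [dist_comm, dist_eq_norm]; exact hclose h hpos.le (by linarith))
      (by rw [dist_self]; positivity) (by linarith) (by linarith)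
    refine ⟨z, hz, ?_⟩
    have h3 : dist (free u (bounceAt Θ₁ Θ₂ h q)).1 (free (h + u) q).1 ≤ 2 * (Δ * c) := by
      rw [free_bounceAt_fst, dist_eq_norm, add_sub_cancel_left, norm_smul, hm, mul_one,
        Real.norm_of_nonneg (by positivity)]
      gcongr
    have h4 := hclose (h + u) (by linarith) (by linarith)
    rw [← dist_eq_norm] at h4
    have h5 := dist_triangle4 (free u (bounceAt Θ₁ Θ₂ h q)).1 (free (h + u) q).1
      (free (h + u) q').1 z
    refine hbase _ (2 * E + 2 * K) dist_nonneg ?_ ?_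
    · linarith
    · have h6 : Δ * c ≤ K * s := hg1
      linarith
  · have h3 := transversal_lipschitz (β := β) (H := H) (by positivity) hr hΔ0 (by linarith) hδ h1
      h2 hδc
    rw [← hM] at h3
    have h4 : Δ * c ≤ M * (E * d) * β := by gcongr
    have h5 : ∀ X Y : ℝ, Y ≤ C → X ≤ Y * d → X ≤ C * d := fun X Y hY hX => hX.trans (by gcongr)
    rw [Prod.dist_eq, max_le_iff]
    refine ⟨h5 _ (E + 2 * β * (M * E)) ?_ (hpos2.trans ?_),
      h5 _ (3 + 4 * β / r * (E + β * (M * E))) ?_ (hvel.trans ?_)⟩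
    · linarith
    · linarith
    · linarith
    · calc _ ≤ 3 * d + 4 * β / r * (E * d + β * (M * (E * d))) := by gcongr
        _ = _ := by ring

/-- Comparison of a reflected ray with a nearby ray that misses the obstacle. -/
theorem exists_reflection_close_of_miss {r α β H : ℝ} (hr : 0 < r) (hα : 0 < α) (hH : 0 ≤ H) :
    ∃ C : ℝ, 1 ≤ C ∧ ∀ Θ₁ Θ₂ Θ : Set E3, IsRound Θ (normalAt Θ₁ Θ₂) r →
      ∀ q q' : Phase, ∀ h d : ℝ, ‖q.2‖ ∈ Set.Icc α β →
      IsFirstHit Θ q h → (∀ s, h ≤ s → (free s q').1 ∉ Θ) → h ≤ H → dist q q' ≤ d → d ≤ 1 →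
      dist (bounceAt Θ₁ Θ₂ h q) (free h q') ≤ C * √d ∧
      -⟪normalAt Θ₁ Θ₂ (free h q).1, q.2⟫ ≤ C * √d := by
  set E := 1 + (H + r / α) with hE
  have hE1 : 1 ≤ E := by rw [hE]; linarith [div_pos hr hα]
  set k := √(2 * E * β ^ 2 / r) with hk
  have hk0 : 0 ≤ k := Real.sqrt_nonneg _
  refine ⟨E + 1 + 2 * k, by linarith, ?_⟩
  intro Θ₁ Θ₂ Θ hΘ q q' h d hq hh hmiss hhH hd hd1
  set n := normalAt Θ₁ Θ₂ with hn
  have hβ : 0 ≤ β := hα.le.trans (hq.1.trans hq.2)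
  have hd0 : 0 ≤ d := dist_nonneg.trans hd
  have hv := hα.trans_le hq.1
  have hq0 : q.2 ≠ 0 := norm_pos_iff.1 hv
  set s := √d with hs
  have hs0 : 0 ≤ s := Real.sqrt_nonneg d
  have hs2 : s ^ 2 = d := Real.sq_sqrt hd0
  have hs1 : s ≤ 1 := Real.sqrt_le_one.2 hd1
  have hds : d ≤ s := by nlinarith
  have hy := hh.mem_frontier hΘ.isClosed
  have hcn := hh.inner_nonpos hΘ
  have hm := hΘ.norm_normal _ hy
  have hpos := hh.pos
  set c := -⟪n (free h q).1, q.2⟫ with hc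
  have hc0 : 0 ≤ c := by linarith
  have hcξ : c ≤ ‖q.2‖ := by
    have := abs_real_inner_le_norm (n (free h q).1) q.2
    rw [hm, one_mul] at this
    exact (neg_le_abs _).trans this
  have hclose : ∀ t, 0 ≤ t → t ≤ H + r / α → ‖(free t q).1 - (free t q').1‖ ≤ E * d :=
    fun t ht htH => dist_free_le ht htH hd
  have hcs : c ≤ k * s := by
    have hrv : r / ‖q.2‖ ≤ r / α := by gcongr; exact hq.1
    have hrv0 : 0 < r / ‖q.2‖ := by positivity
    have h1 : r * c ^ 2 ≤ 2 * (E * d) * ‖q.2‖ ^ 2 := by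
      -- With `w = r / ‖q.2‖` the first alternative also yields the quadratic bound, since `c ≤
      -- ‖q.2‖`.
      rcases hΘ.entry_alternative (q' := q') (w := r / ‖q.2‖) (e := E * d) hy hq0 hrv0.le hcn
        (fun v hv hvw hint => hmiss (h + v) (by linarith) (interior_subset hint))
        (fun v hv hvw => hclose _ (by linarith) (by linarith)) with h3 | h3
      · rw [div_mul_eq_mul_div, div_le_iff₀ hv] at h3
        calc r * c ^ 2 = (r * c) * c := by ring
          _ ≤ (2 * (E * d) * ‖q.2‖) * ‖q.2‖ := by gcongr
          _ = _ := by ring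
      · exact h3
    refine abs_le_of_sq_le_sq' ?_ (by positivity) |>.2
    rw [mul_pow, hk, Real.sq_sqrt (by positivity), div_mul_eq_mul_div, le_div_iff₀ hr, hs2]
    have h4 : ‖q.2‖ ^ 2 ≤ β ^ 2 := by gcongr; exact hq.2
    have h5 : 2 * (E * d) * ‖q.2‖ ^ 2 ≤ 2 * (E * d) * β ^ 2 := by gcongr
    linarith
  refine ⟨?_, hcs.trans (by gcongr; linarith)⟩
  have hk0s : 0 ≤ k * s := by positivity
  rw [Prod.dist_eq, max_le_iff]
  constructor
  · have h1 := hclose h hpos.le (by linarith [div_pos hr hα])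
    rw [← dist_eq_norm] at h1
    refine h1.trans ?_
    nlinarith
  · have h1 : dist q.2 q'.2 ≤ d := (le_max_right _ _).trans hd
    rw [dist_eq_norm] at h1
    rw [dist_eq_norm, free_snd]
    have h2 : (bounceAt Θ₁ Θ₂ h q).2 - q'.2 = (q.2 - q'.2) + (2 * c) • n (free h q).1 := by
      simp only [bounceAt, hc]; module
    rw [h2]
    refine (norm_add_le _ _).trans ?_
    rw [norm_smul, hm, mul_one, Real.norm_of_nonneg (by positivity)]
    nlinarith

/-! ### Intermediate reflections are transversal -/

/-- A ray coming from near `A`, reflected by `B` and meeting `A` again, is not reflected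
tangentially. -/
theorem IsPair.le_of_middle {Θ₁ Θ₂ A B : Set E3} {r D R : ℝ} (hP : IsPair Θ₁ Θ₂ A B r D R)
    {q : Phase} {h k H : ℝ} (hh : IsFirstHit B q h) (hH : h ≤ H)
    (hnear : ∃ a ∈ A, dist q.1 a ≤ D / 4) (hk : 0 < k)
    (hkA : (free k (bounceAt Θ₁ Θ₂ h q)).1 ∈ A) :
    D / (4 * H) ≤ -⟪normalAt Θ₁ Θ₂ (free h q).1, q.2⟫ := by
  obtain ⟨a, ha, had⟩ := hnear
  have hy := hh.mem_frontier hP.right.isClosed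
  have hm := hP.right.norm_normal _ hy
  have hcn := hh.inner_nonpos hP.right
  have hD := hP.gap_pos
  have hpos := hh.pos
  set m := normalAt Θ₁ Θ₂ (free h q).1 with hmdef
  set c := -⟪m, q.2⟫ with hc
  have hc0 : 0 ≤ c := by linarith
  have hhk : 0 < h + k := by linarith
  set z := (free k (bounceAt Θ₁ Θ₂ h q)).1 with hz
  have hzeq : z = (free h q).1 + k • (q.2 + (2 * c) • m) := by
    change (free h q).1 + k • (q.2 - (2 * ⟪m, q.2⟫) • m) = _
    rw [hc]; module
  have h1 : 0 ≤ k / (h + k) := by positivity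
  have h2 : 0 ≤ h / (h + k) := by positivity
  have h3 : k / (h + k) + h / (h + k) = 1 := by field_simp; ring
  -- This point of `A` is at distance at least `D` from the hit point, but differs from it only by
  -- an error of size `D / 4` and a normal vector of length at most `2 * H * c`.
  have hw := hP.left.convex ha hkA h1 h2 h3
  have hgap := hP.gap _ hw _ hh.mem
  have h4 : (k / (h + k)) • a + (h / (h + k)) • z - (free h q).1 =
      (k / (h + k)) • (a - q.1) + (k * h / (h + k) * (2 * c)) • m := by
    have h5 : k / (h + k) * h = k * h / (h + k) := by ring
    have h6 : h / (h + k) * k = k * h / (h + k) := by ring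
    have h7 : h / (h + k) = 1 - k / (h + k) := by linarith
    rw [hzeq, smul_add, smul_smul (h / (h + k)) k, h6, ← h5, h7, free_fst]
    module
  rw [dist_eq_norm, h4] at hgap
  have h5 : ‖(k / (h + k)) • (a - q.1)‖ ≤ D / 4 := by
    rw [norm_smul, Real.norm_of_nonneg h1, norm_sub_rev, ← dist_eq_norm]
    have : k / (h + k) ≤ 1 := by linarith
    exact (mul_le_of_le_one_left dist_nonneg this).trans had
  have h6 : ‖(k * h / (h + k) * (2 * c)) • m‖ ≤ H * (2 * c) := by
    rw [norm_smul, hm, mul_one, Real.norm_of_nonneg (by positivity)]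
    gcongr
    rw [div_le_iff₀ hhk]
    nlinarith
  have h7 := norm_add_le ((k / (h + k)) • (a - q.1)) ((k * h / (h + k) * (2 * c)) • m)
  rw [div_le_iff₀ (by linarith)]
  linarith

/-- `q` is close to `A` and never meets `A` again, and its speed is in `[α, β]`. -/
structure IsOut (A : Set E3) (D α β : ℝ) (q : Phase) : Prop where
  near : ∃ a ∈ A, dist q.1 a ≤ D / 4
  leaves : ∀ s, 0 < s → (free s q).1 ∉ A
  speed : ‖q.2‖ ∈ Set.Icc α β

section

variable {Θ₁ Θ₂ A B : Set E3} {r D R α β : ℝ} {q q' : Phase} {h h' : ℝ}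

theorem ne_zero_of_speed (hα : 0 < α) (hq : ‖q.2‖ ∈ Set.Icc α β) : q.2 ≠ 0 :=
  norm_pos_iff.1 (hα.trans_le hq.1)

theorem IsPair.notMem_of_near (hP : IsPair Θ₁ Θ₂ A B r D R) {x : E3}
    (hx : ∃ a ∈ A, dist x a ≤ D / 4) : x ∉ B := by
  obtain ⟨a, ha, hax⟩ := hx
  intro hB
  have := hP.gap a ha x hB
  rw [dist_comm] at this
  linarith [hP.gap_pos]

theorem IsOut.isTame (hq : IsOut A D α β q) (hP : IsPair Θ₁ Θ₂ A B r D R) :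
    IsTame (Θ₁ ∪ Θ₂) q :=
  hP.isTame_of_leaves hq.leaves (hP.notMem_of_near hq.near)

theorem IsOut.flow_eq_free (hq : IsOut A D α β q) (hP : IsPair Θ₁ Θ₂ A B r D R)
    (hB : ∀ s, 0 < s → (free s q).1 ∉ B) (t : ℝ) : flow Θ₁ Θ₂ t q = free t q := by
  refine Billiard.flow_eq_free (hq.isTame hP) fun s hs _ hmem => ?_
  rw [← hP.union_eq] at hmem
  exact hmem.elim (hq.leaves s hs) (hB s hs)

theorem IsOut.exists_isFirstHit (hq : IsOut A D α β q) (hP : IsPair Θ₁ Θ₂ A B r D R)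
    (hB : ∃ s, 0 < s ∧ (free s q).1 ∈ B) :
    ∃ h, IsFirstHit B q h ∧ IsFirstHit (Θ₁ ∪ Θ₂) q h := by
  obtain ⟨s, hs, hsB⟩ := hB
  obtain ⟨h, -, hh⟩ := Billiard.exists_isFirstHit hP.right.isClosed (hP.notMem_of_near hq.near)
    hs hsB
  exact ⟨h, hh, (hP.isFirstHit_iff_of_leaves hq.leaves).2 hh⟩

theorem IsPair.hit_le (hP : IsPair Θ₁ Θ₂ A B r D R) (hα : 0 < α) (hq : ‖q.2‖ ∈ Set.Icc α β)
    (hx : ‖q.1‖ ≤ R + D) (hh : 0 < h) (hmem : (free h q).1 ∈ Θ₁ ∪ Θ₂) : h ≤ (2 * R + D) / α := by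
  rw [le_div_iff₀ hα]
  have h1 := hP.norm_le _ (hP.union_eq ▸ hmem)
  have h2 : h * ‖q.2‖ ≤ ‖(free h q).1‖ + ‖q.1‖ := by
    have h3 : (free h q).1 - q.1 = h • q.2 := by simp [free_fst]
    rw [← Real.norm_of_nonneg hh.le, ← norm_smul, Real.norm_of_nonneg hh.le, ← h3]
    exact norm_sub_le _ _
  have h4 : h * α ≤ h * ‖q.2‖ := by gcongr; exact hq.1
  linarith

theorem IsOut.norm_le (hq : IsOut A D α β q) (hP : IsPair Θ₁ Θ₂ A B r D R) : ‖q.1‖ ≤ R + D := by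
  obtain ⟨a, ha, had⟩ := hq.near
  have h1 := hP.norm_le a (.inl ha)
  rw [dist_eq_norm] at had
  have h2 : q.1 = a + (q.1 - a) := by abel
  rw [h2]
  exact (norm_add_le _ _).trans (by linarith [hP.gap_pos])

/-- The lower bound on the duration of a step, which keeps the number of steps linear in time. -/
theorem IsOut.le_hit (hq : IsOut A D α β q) (hP : IsPair Θ₁ Θ₂ A B r D R) (hα : 0 < α)
    (hh : IsFirstHit B q h) : D / (2 * β) ≤ h := by
  obtain ⟨a, ha, had⟩ := hq.near
  have hv := hα.trans_le hq.speed.1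
  have hβ := hv.trans_le hq.speed.2
  have h1 := hP.gap a ha _ hh.mem
  have h2 := dist_triangle a q.1 (free h q).1
  have h3 : dist q.1 (free h q).1 = h * ‖q.2‖ := by
    rw [dist_eq_norm, free_fst, sub_add_cancel_left, norm_neg, norm_smul,
      Real.norm_of_nonneg hh.pos.le]
  rw [dist_comm] at had
  have h4 : h * ‖q.2‖ ≤ h * β := by
    have := hh.pos.le
    gcongr; exact hq.speed.2
  rw [div_le_iff₀ (by positivity)]
  linarith [hP.gap_pos]

/-- After the reflection by `B` the flow is a free motion until the first hit of `A`. -/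
theorem IsPair.flow_add_of_hit (hP : IsPair Θ₁ Θ₂ A B r D R) (hα : 0 < α)
    (hq : ‖q.2‖ ∈ Set.Icc α β) (hh : IsFirstHit (Θ₁ ∪ Θ₂) q h) (hy : (free h q).1 ∈ B) {v : ℝ}
    (hv : 0 ≤ v)
    (hnear : ∀ s, 0 ≤ s → s ≤ v → ∃ b ∈ B, dist (free s (bounceAt Θ₁ Θ₂ h q)).1 b ≤ D / 4) :
    IsOut B D α β (free v (bounceAt Θ₁ Θ₂ h q)) ∧ ∀ u, 0 ≤ u →
      flow Θ₁ Θ₂ (h + v + u) q = flow Θ₁ Θ₂ u (free v (bounceAt Θ₁ Θ₂ h q)) := by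
  have hhB : IsFirstHit B q h := hh.subset (hP.union_eq ▸ Set.subset_union_right) hy
  have hq0 := ne_zero_of_speed hα hq
  have hl := hP.leaves_bounceAt hhB hq0
  have hn := hP.norm_bounceAt hhB
  have hb0 : (bounceAt Θ₁ Θ₂ h q).2 ≠ 0 := by
    rw [← norm_pos_iff, hn]; exact norm_pos_iff.2 hq0
  refine ⟨⟨hnear v hv le_rfl, fun s hs => ?_, by rw [free_snd, hn]; exact hq⟩, fun u hu => ?_⟩
  · rw [free_free]; exact hl.2 _ (by linarith)
  · rw [hP.flow_eq_flow_bounceAt hh hq0 (by linarith), show h + v + u - h = v + u by ring]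
    refine hP.flow_add (hP.symm.isTame_of_leaves hl.2 (hP.symm.disjoint hl.1)) hb0 hv
      fun s hs hsv hmem => ?_
    rw [← hP.union_eq] at hmem
    exact hmem.elim (hP.symm.notMem_of_near (hnear s hs.le hsv)) (hl.2 s hs)

end

/-! ### Synchronized comparison across one reflection -/

/-- Two nearby rays reflected by the same obstacle `B` are compared at the later one of the two
times of reflection. -/
theorem exists_sync_of_hit {r D R α β H : ℝ} (hr : 0 < r) (hD : 0 < D) (hα : 0 < α) (hH : 0 < H) :
    ∃ C : ℝ, 1 ≤ C ∧ ∃ d₀ : ℝ, 0 < d₀ ∧ ∀ Θ₁ Θ₂ A B : Set E3, IsPair Θ₁ Θ₂ A B r D R →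
      ∀ (q q' : Phase) (h h' d : ℝ), ‖q.2‖ ∈ Set.Icc α β → ‖q'.2‖ ∈ Set.Icc α β →
      IsFirstHit (Θ₁ ∪ Θ₂) q h → IsFirstHit (Θ₁ ∪ Θ₂) q' h' → (free h q).1 ∈ B →
      (free h' q').1 ∈ B → h ≤ H → h' ≤ H → dist q q' ≤ d → d ≤ d₀ →
      ∃ S q₁ q₁', h ≤ S ∧ h' ≤ S ∧ S ≤ H ∧ IsOut B D α β q₁ ∧ IsOut B D α β q₁' ∧
        (∀ u, 0 ≤ u → flow Θ₁ Θ₂ (S + u) q = flow Θ₁ Θ₂ u q₁) ∧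
        (∀ u, 0 ≤ u → flow Θ₁ Θ₂ (S + u) q' = flow Θ₁ Θ₂ u q₁') ∧
        dist q₁ q₁' ≤ C * √d ∧
        ((∃ a ∈ A, dist q.1 a ≤ D / 4) → (∃ a ∈ A, dist q'.1 a ≤ D / 4) →
          ((∃ s, 0 < s ∧ (free s q₁).1 ∈ A) ∨ ∃ s, 0 < s ∧ (free s q₁').1 ∈ A) →
          dist q₁ q₁' ≤ C * d) := by
  obtain ⟨C, hC1, hC⟩ := exists_reflection_close (β := β) (δ := D / (4 * H)) hr hα hH.le
    (by positivity)
  -- This makes `C * √d ≤ D / 4`: until the later hit, the ray reflected earlier stays too close to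
  -- `B` to meet `A`.
  refine ⟨C, hC1, min 1 ((D / 4 / C) ^ 2), by positivity, ?_⟩
  intro Θ₁ Θ₂ A B hP q q' h h' d hq hq' hh hh' hy hy' hhH hh'H hd hd0
  wlog hle : h ≤ h' generalizing q q' h h' with W
  · obtain ⟨S, q₁, q₁', h0, h1, h2, h3, h4, h5, h6, h7, h8⟩ := W q' q h' h hq' hq hh' hh hy' hy hh'H hhH
      (by rwa [dist_comm]) (not_le.1 hle).le
    exact ⟨S, q₁', q₁, h1, h0, h2, h4, h3, h6, h5, by rwa [dist_comm],
      fun a b c => by rw [dist_comm]; exact h8 b a c.symm⟩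
  have hBsub : B ⊆ Θ₁ ∪ Θ₂ := hP.union_eq ▸ Set.subset_union_right
  have hhB := hh.subset hBsub hy
  have hhB' := hh'.subset hBsub hy'
  obtain ⟨h1, h2, h3⟩ := hC Θ₁ Θ₂ B hP.right q q' h h' d hq hq' hhB hhB' hle hh'H hd
    (hd0.trans (min_le_left _ _))
  have hsmall : C * √d ≤ D / 4 := by
    rw [mul_comm, ← le_div_iff₀ (by positivity)]
    exact Real.sqrt_le_iff.2 ⟨by positivity, hd0.trans (min_le_right _ _)⟩
  obtain ⟨ho, hf⟩ := hP.flow_add_of_hit hα hq hh hy (v := h' - h) (by linarith)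
    fun s hs hsv => by
      obtain ⟨z, hz, hzd⟩ := h2 s hs hsv
      exact ⟨z, hz, hzd.trans hsmall⟩
  obtain ⟨ho', hf'⟩ := hP.flow_add_of_hit hα hq' hh' hy' le_rfl fun s hs hsv =>
    ⟨_, hy', by
      rw [le_antisymm hsv hs, free_zero]
      change dist (free h' q').1 (free h' q').1 ≤ _
      rw [dist_self]; positivity⟩
  rw [free_zero] at ho'
  refine ⟨h', _, _, hle, le_rfl, hh'H, ho, ho', fun u hu => ?_, fun u hu => ?_, h1,
    fun hn hn' hs => h3 (hs.imp ?_ ?_)⟩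
  · rw [← hf u hu]; congr 1; ring
  · simpa using hf' u hu
  · rintro ⟨s, hs, hsA⟩
    rw [free_free] at hsA
    exact hP.le_of_middle hhB hhH hn (by linarith) hsA
  · rintro ⟨s, hs, hsA⟩
    exact hP.le_of_middle hhB' hh'H hn' hs hsA

/-- A ray reflected by `B` is compared with a nearby ray that is not reflected by `B` but may be
reflected by `A` later. -/
theorem exists_sync_of_miss {r D R α β H : ℝ} (hr : 0 < r) (hD : 0 < D) (hα : 0 < α) (hH : 0 < H) :
    ∃ C : ℝ, 1 ≤ C ∧ ∃ d₀ : ℝ, 0 < d₀ ∧ ∀ Θ₁ Θ₂ A B : Set E3, IsPair Θ₁ Θ₂ A B r D R →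
      ∀ (q q' : Phase) (h d : ℝ), ‖q.2‖ ∈ Set.Icc α β → ‖q'.2‖ ∈ Set.Icc α β →
      IsFirstHit (Θ₁ ∪ Θ₂) q h → (free h q).1 ∈ B → IsTame (Θ₁ ∪ Θ₂) q' →
      (∀ s, 0 < s → s < h → (free s q').1 ∉ Θ₁ ∪ Θ₂) →
      (∀ s, h ≤ s → (free s q').1 ∈ B → ∃ u, h ≤ u ∧ u ≤ s ∧ (free u q').1 ∈ A) →
      h ≤ H → dist q q' ≤ d → d ≤ d₀ →
      ∃ q₁ q₁', IsOut B D α β q₁ ∧ IsOut B D α β q₁' ∧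
        (∀ u, 0 ≤ u → flow Θ₁ Θ₂ (h + u) q = flow Θ₁ Θ₂ u q₁) ∧
        (∀ u, 0 ≤ u → flow Θ₁ Θ₂ (h + u) q' = flow Θ₁ Θ₂ u q₁') ∧
        dist q₁ q₁' ≤ C * √d ∧ q₁' = free h q' ∧
        ((∃ a ∈ A, dist q.1 a ≤ D / 4) → ∀ s, 0 < s → (free s q₁).1 ∉ A) := by
  obtain ⟨C, hC1, hC⟩ := exists_reflection_close_of_miss (β := β) hr hα hH.le
  -- The value `D / (8 * H)` is below the bound of `IsPair.le_of_middle`, so a hit this grazing, by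
  -- a ray from near `A`, is not followed by a return to `A`.
  set δ := min (D / 4) (D / (8 * H)) with hδ
  have hδ0 : 0 < δ := by positivity
  refine ⟨C, hC1, min (min 1 (D / 4 / (1 + H))) ((δ / C) ^ 2), by positivity, ?_⟩
  intro Θ₁ Θ₂ A B hP q q' h d hq hq' hh hy htame hfree hmiss hhH hd hd0
  have hd1 : d ≤ 1 := hd0.trans ((min_le_left _ _).trans (min_le_left _ _))
  have hd2 : (1 + H) * d ≤ D / 4 := by
    rw [mul_comm, ← le_div_iff₀ (by positivity)]
    exact hd0.trans ((min_le_left _ _).trans (min_le_right _ _))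
  have hd3 : C * √d ≤ δ := by
    rw [mul_comm, ← le_div_iff₀ (by positivity)]
    exact Real.sqrt_le_iff.2 ⟨by positivity, hd0.trans (min_le_right _ _)⟩
  have hBsub : B ⊆ Θ₁ ∪ Θ₂ := hP.union_eq ▸ Set.subset_union_right
  have hhB := hh.subset hBsub hy
  have hpos := hh.pos
  have hclose : dist (free h q').1 (free h q).1 ≤ D / 4 := by
    rw [dist_comm, dist_eq_norm]
    exact (dist_free_le hpos.le hhH hd).trans hd2
  -- To reach `B` the second ray would first have to meet `A`, but convexity keeps it within `D / 4`
  -- of `B` in between.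
  have hmissB : ∀ s, h ≤ s → (free s q').1 ∉ B := by
    intro s hs hsB
    obtain ⟨u, hu, hus, huA⟩ := hmiss s hs hsB
    exact hP.symm.notMem_of_near (exists_dist_free_le hP.right.convex hy hsB hclose
      (by rw [dist_self]; positivity) hu hus) huA
  obtain ⟨h1, h2⟩ := hC Θ₁ Θ₂ B hP.right q q' h d hq hhB hmissB hhH hd hd1
  obtain ⟨ho, hf⟩ := hP.flow_add_of_hit hα hq hh hy le_rfl fun s hs hsv =>
    ⟨_, hy, by
      rw [le_antisymm hsv hs, free_zero]
      change dist (free h q).1 (free h q).1 ≤ _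
      rw [dist_self]; positivity⟩
  rw [free_zero] at ho
  refine ⟨_, _, ho, ⟨⟨_, hy, hclose⟩, fun s hs => ?_, hq'⟩, fun u hu => ?_, fun u hu => ?_, h1,
    rfl, fun hn s hs hsA => ?_⟩
  · rw [free_free]; exact hmissB _ (by linarith)
  · simpa using hf u hu
  · exact hP.flow_add htame (ne_zero_of_speed hα hq') hpos.le fun s hs hsh => by
      rcases hsh.eq_or_lt with rfl | hlt
      · rw [← hP.union_eq]
        exact fun hmem => hmem.elim (hP.symm.notMem_of_near ⟨_, hy, hclose⟩) (hmissB s le_rfl)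
      · exact hfree s hs hlt
  · have h3 := hP.le_of_middle hhB hhH hn hs hsA
    have h4 : D / (4 * H) = 2 * (D / (8 * H)) := by field_simp; ring
    have h5 : δ ≤ D / (8 * H) := min_le_right _ _
    have h6 : 0 < D / (8 * H) := by positivity
    linarith

/-- One step in the comparison of two nearby rays moving away from `A`: either both move freely
forever, or there is a later time at which both move away from `B`, the distance having grown by a
bounded factor, unless both move freely afterwards. -/
theorem exists_step {r D R α β : ℝ} (hr : 0 < r) (hD : 0 < D) (hα : 0 < α) (hR : 0 ≤ R) :
    ∃ C : ℝ, 1 ≤ C ∧ ∃ d₀ : ℝ, 0 < d₀ ∧ ∀ Θ₁ Θ₂ A B : Set E3, IsPair Θ₁ Θ₂ A B r D R →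
      ∀ (q q' : Phase) (d : ℝ), IsOut A D α β q → IsOut A D α β q' → dist q q' ≤ d → d ≤ d₀ →
      ((∀ s, 0 < s → (free s q).1 ∉ B) ∧ ∀ s, 0 < s → (free s q').1 ∉ B) ∨
      ∃ S q₁ q₁', D / (2 * β) ≤ S ∧ S ≤ (2 * R + D) / α ∧
        IsOut B D α β q₁ ∧ IsOut B D α β q₁' ∧
        (∀ u, 0 ≤ u → flow Θ₁ Θ₂ (S + u) q = flow Θ₁ Θ₂ u q₁) ∧
        (∀ u, 0 ≤ u → flow Θ₁ Θ₂ (S + u) q' = flow Θ₁ Θ₂ u q₁') ∧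
        ((((∀ s, 0 < s → (free s q₁).1 ∉ A) ∧ ∀ s, 0 < s → (free s q₁').1 ∉ A) ∧
          dist q₁ q₁' ≤ C * √d) ∨ dist q₁ q₁' ≤ C * d) := by
  set H := (2 * R + D) / α with hH
  have hH0 : 0 < H := by positivity
  obtain ⟨C₁, hC₁, d₁, hd₁, hit⟩ := exists_sync_of_hit (R := R) (β := β) hr hD hα hH0
  obtain ⟨C₂, hC₂, d₂, hd₂, miss⟩ := exists_sync_of_miss (R := R) (β := β) hr hD hα hH0
  refine ⟨max C₁ C₂, le_max_of_le_left hC₁, min d₁ d₂, by positivity, ?_⟩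
  intro Θ₁ Θ₂ A B hP q q' d hq hq' hd hd0
  have hd0' : 0 ≤ d := dist_nonneg.trans hd
  have hOA : ∀ z, z ∈ Θ₁ ∪ Θ₂ ↔ z ∈ A ∨ z ∈ B := fun z => by rw [← hP.union_eq]; rfl
  have missing : ∀ q q' : Phase, IsOut A D α β q → IsOut A D α β q' → dist q q' ≤ d →
      (∃ s, 0 < s ∧ (free s q).1 ∈ B) → (∀ s, 0 < s → (free s q').1 ∉ B) →
      ∃ S q₁ q₁', D / (2 * β) ≤ S ∧ S ≤ (2 * R + D) / α ∧
        IsOut B D α β q₁ ∧ IsOut B D α β q₁' ∧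
        (∀ u, 0 ≤ u → flow Θ₁ Θ₂ (S + u) q = flow Θ₁ Θ₂ u q₁) ∧
        (∀ u, 0 ≤ u → flow Θ₁ Θ₂ (S + u) q' = flow Θ₁ Θ₂ u q₁') ∧
        ((∀ s, 0 < s → (free s q₁).1 ∉ A) ∧ ∀ s, 0 < s → (free s q₁').1 ∉ A) ∧
          dist q₁ q₁' ≤ max C₁ C₂ * √d := by
    intro q q' hq hq' hd hB hB'
    obtain ⟨h, hhB, hh⟩ := hq.exists_isFirstHit hP hB
    have hhH := hP.hit_le hα hq.speed (hq.norm_le hP) hh.pos hh.mem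
    obtain ⟨q₁, q₁', h1, h2, h3, h4, h5, h6, h7⟩ := miss Θ₁ Θ₂ A B hP q q' h d hq.speed hq'.speed hh
      hhB.mem (hq'.isTame hP)
      (fun s hs _ hmem => ((hOA _).1 hmem).elim (hq'.leaves s hs) (hB' s hs))
      (fun s hs hsB => absurd hsB (hB' s (hh.pos.trans_le hs))) hhH hd
      (hd0.trans (min_le_right _ _))
    refine ⟨h, q₁, q₁', hq.le_hit hP hα hhB, hhH, h1, h2, h3, h4, ⟨h7 hq.near, fun s hs => ?_⟩,
      h5.trans (by gcongr; exact le_max_right _ _)⟩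
    rw [h6, free_free]
    exact hq'.leaves _ (by linarith [hh.pos])
  by_cases hB : ∃ s, 0 < s ∧ (free s q).1 ∈ B <;> by_cases hB' : ∃ s, 0 < s ∧ (free s q').1 ∈ B
  · right
    obtain ⟨h, hhB, hh⟩ := hq.exists_isFirstHit hP hB
    obtain ⟨h', hhB', hh'⟩ := hq'.exists_isFirstHit hP hB'
    obtain ⟨S, q₁, q₁', h1, -, h2, h3, h4, h5, h6, h7, h8⟩ := hit Θ₁ Θ₂ A B hP q q' h h' d hq.speed
      hq'.speed hh hh' hhB.mem hhB'.mem (hP.hit_le hα hq.speed (hq.norm_le hP) hh.pos hh.mem)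
      (hP.hit_le hα hq'.speed (hq'.norm_le hP) hh'.pos hh'.mem) hd (hd0.trans (min_le_left _ _))
    refine ⟨S, q₁, q₁', (hq.le_hit hP hα hhB).trans h1, h2, h3, h4, h5, h6, ?_⟩
    -- A return of either ray to `A` makes the reflection transversal and the estimate Lipschitz;
    -- without one, both rays are free afterwards and the square root is the last loss.
    by_cases hA : (∃ s, 0 < s ∧ (free s q₁).1 ∈ A) ∨ ∃ s, 0 < s ∧ (free s q₁').1 ∈ A
    · exact .inr ((h8 hq.near hq'.near hA).trans (by gcongr; exact le_max_left _ _))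
    · push Not at hA
      exact .inl ⟨hA, h7.trans (by gcongr; exact le_max_left _ _)⟩
  · push Not at hB'
    obtain ⟨S, q₁, q₁', h1, h2, h3, h4, h5, h6, h7⟩ := missing q q' hq hq' hd hB hB'
    exact .inr ⟨S, q₁, q₁', h1, h2, h3, h4, h5, h6, .inl h7⟩
  · push Not at hB
    obtain ⟨S, q₁, q₁', h1, h2, h3, h4, h5, h6, h7, h8⟩ := missing q' q hq' hq
      (by rwa [dist_comm]) hB' hB
    exact .inr ⟨S, q₁', q₁, h1, h2, h4, h3, h6, h5, .inl ⟨h7.symm, by rwa [dist_comm]⟩⟩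
  · push Not at hB hB'
    exact .inl ⟨hB, hB'⟩

/-- The first step in the comparison of two nearby rays that start outside the obstacles. -/
theorem exists_first_step {r D R α β : ℝ} (hr : 0 < r) (hD : 0 < D) (hα : 0 < α) (hR : 0 ≤ R) :
    ∃ C : ℝ, 1 ≤ C ∧ ∃ d₀ : ℝ, 0 < d₀ ∧ ∀ Θ₁ Θ₂ A B : Set E3, IsPair Θ₁ Θ₂ A B r D R →
      ∀ (q q' : Phase) (d : ℝ), ‖q.2‖ ∈ Set.Icc α β → ‖q'.2‖ ∈ Set.Icc α β →
      ‖q.1‖ ≤ R + D → ‖q'.1‖ ≤ R + D → q.1 ∉ Θ₁ ∪ Θ₂ → q'.1 ∉ Θ₁ ∪ Θ₂ →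
      dist q q' ≤ d → d ≤ d₀ →
      ((∀ s, 0 < s → (free s q).1 ∉ Θ₁ ∪ Θ₂) ∧ ∀ s, 0 < s → (free s q').1 ∉ Θ₁ ∪ Θ₂) ∨
      ∃ A B, IsPair Θ₁ Θ₂ A B r D R ∧ ∃ S q₁ q₁', 0 ≤ S ∧ S ≤ (2 * R + D) / α ∧
        IsOut B D α β q₁ ∧ IsOut B D α β q₁' ∧
        (∀ u, 0 ≤ u → flow Θ₁ Θ₂ (S + u) q = flow Θ₁ Θ₂ u q₁) ∧
        (∀ u, 0 ≤ u → flow Θ₁ Θ₂ (S + u) q' = flow Θ₁ Θ₂ u q₁') ∧ dist q₁ q₁' ≤ C * √d := by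
  set H := (2 * R + D) / α with hH
  have hH0 : 0 < H := by positivity
  obtain ⟨C₁, hC₁, d₁, hd₁, hit⟩ := exists_sync_of_hit (R := R) (β := β) hr hD hα hH0
  obtain ⟨C₂, hC₂, d₂, hd₂, miss⟩ := exists_sync_of_miss (R := R) (β := β) hr hD hα hH0
  refine ⟨max C₁ C₂, le_max_of_le_left hC₁, min d₁ d₂, by positivity, ?_⟩
  intro Θ₁ Θ₂ A B hP q q' d hq hq' hx hx' hout hout' hd hd0
  have hcl : IsClosed (Θ₁ ∪ Θ₂) := hP.union_eq ▸ hP.isClosed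
  have htame := isTame_of_notMem hcl hout
  have htame' := isTame_of_notMem hcl hout'
  by_cases hnone : (∀ s, 0 < s → (free s q).1 ∉ Θ₁ ∪ Θ₂) ∧
      ∀ s, 0 < s → (free s q').1 ∉ Θ₁ ∪ Θ₂
  · exact .inl hnone
  right
  -- By symmetry, `q` is the ray that hits first.
  wlog hfirst : ∃ h, IsFirstHit (Θ₁ ∪ Θ₂) q h ∧ ∀ h', IsFirstHit (Θ₁ ∪ Θ₂) q' h' → h ≤ h'
    generalizing q q' with W
  · have hother : ∃ h, IsFirstHit (Θ₁ ∪ Θ₂) q' h ∧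
        ∀ h', IsFirstHit (Θ₁ ∪ Θ₂) q h' → h ≤ h' := by
      rcases htame with h1 | ⟨h, hh⟩
      · rcases htame' with h2 | ⟨h', hh'⟩
        · exact absurd ⟨h1, h2⟩ hnone
        · exact ⟨h', hh', fun k hk => absurd hk.mem (h1 k hk.pos)⟩
      · push Not at hfirst
        obtain ⟨h', hh', hlt⟩ := hfirst h hh
        refine ⟨h', hh', fun k hk => ?_⟩
        by_contra! hkh
        exact hh.before k hk.pos (hkh.trans hlt) hk.mem
    obtain ⟨A, B, hP', S, q₁, q₁', h1, h2, h3, h4, h5, h6, h7⟩ := W q' q hq' hq hx' hx hout' hout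
      (by rwa [dist_comm]) htame' htame (fun hh => hnone hh.symm) hother
    exact ⟨A, B, hP', S, q₁', q₁, h1, h2, h4, h3, h6, h5, by rwa [dist_comm]⟩
  obtain ⟨h, hh, hmin⟩ := hfirst
  wlog hy : (free h q).1 ∈ B generalizing A B with W
  · exact W B A hP.symm (((hP.union_eq ▸ hh.mem : _ ∈ A ∪ B)).resolve_right hy)
  have hhH := hP.hit_le hα hq hx hh.pos hh.mem
  by_cases hsame : ∃ h', IsFirstHit (Θ₁ ∪ Θ₂) q' h' ∧ (free h' q').1 ∈ B
  · obtain ⟨h', hh', hy'⟩ := hsame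
    obtain ⟨S, q₁, q₁', h1, -, h2, h3, h4, h5, h6, h7, -⟩ := hit Θ₁ Θ₂ A B hP q q' h h' d hq hq' hh hh'
      hy hy' hhH (hP.hit_le hα hq' hx' hh'.pos hh'.mem) hd (hd0.trans (min_le_left _ _))
    exact ⟨A, B, hP, S, q₁, q₁', hh.pos.le.trans h1, h2, h3, h4, h5, h6,
      h7.trans (by gcongr; exact le_max_left _ _)⟩
  · push Not at hsame
    have hbefore : ∀ s, 0 < s → s < h → (free s q').1 ∉ Θ₁ ∪ Θ₂ := fun s hs hsh hmem => by
      obtain ⟨k, hks, hk⟩ := exists_isFirstHit hcl hout' hs hmem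
      linarith [hmin k hk]
    have hafter : ∀ s, h ≤ s → (free s q').1 ∈ B → ∃ u, h ≤ u ∧ u ≤ s ∧ (free u q').1 ∈ A :=
      fun s hs hmem => by
        obtain ⟨k, hks, hk⟩ := exists_isFirstHit hcl hout' (hh.pos.trans_le hs)
          (hP.union_eq ▸ Set.mem_union_right A hmem)
        exact ⟨k, hmin k hk, hks,
          ((hP.union_eq ▸ hk.mem : _ ∈ A ∪ B)).resolve_right (hsame k hk)⟩
    obtain ⟨q₁, q₁', h1, h2, h3, h4, h5, -, -⟩ := miss Θ₁ Θ₂ A B hP q q' h d hq hq' hh hy htame'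
      hbefore hafter hhH hd (hd0.trans (min_le_right _ _))
    exact ⟨A, B, hP, h, q₁, q₁', hh.pos.le, hhH, h1, h2, h3, h4,
      h5.trans (by gcongr; exact le_max_right _ _)⟩

/-! ### Iteration over the reflections -/

theorem dist_free_free_le {q q' : Phase} {s d : ℝ} (hs : 0 ≤ s) (hd : dist q q' ≤ d) :
    dist (free s q) (free s q') ≤ (1 + s) * d := by
  have hd0 : 0 ≤ d := dist_nonneg.trans hd
  rw [Prod.dist_eq, max_le_iff]
  refine ⟨by rw [dist_eq_norm]; exact dist_free_le hs le_rfl hd, ?_⟩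
  have h1 : dist q.2 q'.2 ≤ d := (le_max_right _ _).trans hd
  simp only [free_snd]
  nlinarith

theorem le_sqrt_self {d : ℝ} (h0 : 0 ≤ d) (h1 : d ≤ 1) : d ≤ √d :=
  Real.le_sqrt_of_sq_le (by nlinarith)

/-- Comparison of two nearby rays moving away from the same obstacle: every time is followed, up
to a bounded delay, by a time at which they are close. -/
theorem exists_comparison_of_isOut {r D R α β : ℝ} (hr : 0 < r) (hD : 0 < D) (hα : 0 < α)
    (hR : 0 ≤ R) :
    ∃ L : ℝ, 1 ≤ L ∧ ∃ η : ℝ, 0 < η ∧ ∀ Θ₁ Θ₂ : Set E3, ∀ n : ℕ, ∀ A B : Set E3,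
      IsPair Θ₁ Θ₂ A B r D R → ∀ (q q' : Phase) (d t : ℝ), IsOut A D α β q → IsOut A D α β q' →
      dist q q' ≤ d → d * L ^ n ≤ η → 0 ≤ t → t ≤ n * (D / (2 * β)) →
      ∃ t', t ≤ t' ∧ t' ≤ t + (2 * R + D) / α ∧
        dist (flow Θ₁ Θ₂ t' q) (flow Θ₁ Θ₂ t' q') ≤ L * (1 + t') * L ^ n * √d := by
  obtain ⟨C, hC1, d₀, hd₀, step⟩ := exists_step (β := β) hr hD hα hR
  refine ⟨C, hC1, min 1 d₀, by positivity, fun Θ₁ Θ₂ n => ?_⟩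
  set H := (2 * R + D) / α with hH
  have hH0 : 0 < H := by positivity
  induction n using Nat.strong_induction_on with
  | _ n ih =>
    intro A B hP q q' d t hq hq' hd hdn ht htn
    have hβ : 0 < β := hα.trans_le (hq.speed.1.trans hq.speed.2)
    have hd0 : 0 ≤ d := dist_nonneg.trans hd
    have hCn : 1 ≤ C ^ n := one_le_pow₀ hC1
    have hdd : d ≤ min 1 d₀ := (le_mul_of_one_le_right hd0 hCn).trans hdn
    have hds : d ≤ √d := le_sqrt_self hd0 (hdd.trans (min_le_left _ _))
    have hs0 : 0 ≤ √d := Real.sqrt_nonneg d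
    have hbound : ∀ t', 0 ≤ t' → C * (1 + t') * √d ≤ C * (1 + t') * C ^ n * √d := fun t' h => by
      have : C * (1 + t') ≤ C * (1 + t') * C ^ n := le_mul_of_one_le_right (by positivity) hCn
      gcongr
    rcases step Θ₁ Θ₂ A B hP q q' d hq hq' hd (hdd.trans (min_le_right _ _)) with
      ⟨hB, hB'⟩ | ⟨S, q₁, q₁', hS, hSH, hq₁, hq₁', hf, hf', hcase⟩
    · refine ⟨t, le_rfl, by linarith, ?_⟩
      rw [hq.flow_eq_free hP hB, hq'.flow_eq_free hP hB']
      refine (dist_free_free_le ht hd).trans (le_trans ?_ (hbound t ht))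
      have : 1 + t ≤ C * (1 + t) := le_mul_of_one_le_left (by linarith) hC1
      gcongr
    · have hS0 : 0 < S := lt_of_lt_of_le (by positivity) hS
      rcases hcase with ⟨⟨hA, hA'⟩, hdist⟩ | hdist
      · have hm := le_max_right t S
        refine ⟨max t S, le_max_left _ _, max_le (by linarith) (by linarith), ?_⟩
        have h1 := hf (max t S - S) (by linarith)
        have h2 := hf' (max t S - S) (by linarith)
        rw [add_sub_cancel] at h1 h2
        rw [h1, h2, hq₁.flow_eq_free hP.symm hA, hq₁'.flow_eq_free hP.symm hA']
        refine (dist_free_free_le (by linarith) hdist).trans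
          (le_trans ?_ (hbound _ (by linarith)))
        calc _ ≤ (1 + max t S) * (C * √d) := by gcongr; linarith
          _ = _ := by ring
      · by_cases htS : t ≤ S
        · refine ⟨S, htS, by linarith, ?_⟩
          have h1 := hf 0 le_rfl
          have h2 := hf' 0 le_rfl
          rw [flow_eq_free (hq₁.isTame hP.symm) fun s hs hs' => by linarith, free_zero,
            add_zero] at h1
          rw [flow_eq_free (hq₁'.isTame hP.symm) fun s hs hs' => by linarith, free_zero,
            add_zero] at h2
          rw [h1, h2]
          refine hdist.trans (le_trans ?_ (hbound S hS0.le))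
          have : C ≤ C * (1 + S) := le_mul_of_one_le_right (by linarith) (by linarith)
          gcongr
        · push Not at htS
          obtain ⟨m, rfl⟩ : ∃ m, n = m + 1 := Nat.exists_eq_succ_of_ne_zero fun h0 => by
            rw [h0] at htn
            simp only [Nat.cast_zero, zero_mul] at htn
            linarith
          -- The step replaces `d` by `C * d` and `t` by `t - S`; since `S ≥ D / (2 * β)`, one unit
          -- of `n` pays for it.
          obtain ⟨t'', h1, h2, h3⟩ := ih m (Nat.lt_succ_self m) B A hP.symm q₁ q₁' (C * d) (t - S)
            hq₁ hq₁' hdist (by rw [pow_succ] at hdn; linarith) (by linarith)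
            (by push_cast at htn; linarith)
          refine ⟨S + t'', by linarith, by linarith, ?_⟩
          rw [hf _ (by linarith), hf' _ (by linarith)]
          refine h3.trans ?_
          have h4 : √(C * d) ≤ C * √d := by
            rw [Real.sqrt_mul (by linarith)]
            gcongr
            exact Real.sqrt_le_left (by linarith) |>.2 (by nlinarith)
          have h5 : 0 ≤ 1 + (S + t'') := by linarith
          calc C * (1 + t'') * C ^ m * √(C * d) ≤ C * (1 + (S + t'')) * C ^ m * (C * √d) := by
                gcongr; linarith
            _ = _ := by ring

/-- Comparison of two nearby rays starting outside the obstacles. -/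
theorem exists_comparison {r D R α β : ℝ} (hr : 0 < r) (hD : 0 < D) (hα : 0 < α) (hR : 0 ≤ R) :
    ∃ L : ℝ, 1 ≤ L ∧ ∃ K : ℝ, 0 < K ∧ ∃ d₁ : ℝ, 0 < d₁ ∧ ∀ Θ₁ Θ₂ A B : Set E3,
      IsPair Θ₁ Θ₂ A B r D R → ∀ (n : ℕ) (q q' : Phase) (d t : ℝ),
      ‖q.2‖ ∈ Set.Icc α β → ‖q'.2‖ ∈ Set.Icc α β →
      ‖q.1‖ ≤ R + D → ‖q'.1‖ ≤ R + D → q.1 ∉ Θ₁ ∪ Θ₂ → q'.1 ∉ Θ₁ ∪ Θ₂ →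
      dist q q' ≤ d → d * L ^ (2 * n) ≤ d₁ → 0 ≤ t → t ≤ n * (D / (2 * β)) →
      ∃ t', t ≤ t' ∧ t' ≤ t + 2 * ((2 * R + D) / α) ∧
        dist (flow Θ₁ Θ₂ t' q) (flow Θ₁ Θ₂ t' q') ≤ K * (1 + t') * L ^ n * √√d := by
  obtain ⟨L, hL, η, hη, comp⟩ := exists_comparison_of_isOut (β := β) hr hD hα hR
  obtain ⟨C, hC, d₀, hd₀, first⟩ := exists_first_step (β := β) hr hD hα hR
  set H := (2 * R + D) / α with hH
  have hH0 : 0 < H := by positivity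
  -- The first step turns `d` into `C * √d`, which the iteration needs below `η` after
  -- multiplication by `L ^ n`; squaring gives `(η / C) ^ 2` and the exponent `2 * n`.
  refine ⟨L, hL, L * C, by positivity, min (min 1 d₀) ((η / C) ^ 2), by positivity, ?_⟩
  intro Θ₁ Θ₂ A B hP n q q' d t hq hq' hx hx' hout hout' hd hdn ht htn
  have hd0 : 0 ≤ d := dist_nonneg.trans hd
  have hLn : 1 ≤ L ^ n := one_le_pow₀ hL
  have hdd : d ≤ min 1 d₀ := (le_mul_of_one_le_right hd0 (one_le_pow₀ hL)).trans
    (hdn.trans (min_le_left _ _))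
  have hd1 : d ≤ 1 := hdd.trans (min_le_left _ _)
  have hss : d ≤ √√d := (le_sqrt_self hd0 hd1).trans
    (le_sqrt_self (Real.sqrt_nonneg d) (Real.sqrt_le_one.2 hd1))
  have hcl : IsClosed (Θ₁ ∪ Θ₂) := hP.union_eq ▸ hP.isClosed
  rcases first Θ₁ Θ₂ A B hP q q' d hq hq' hx hx' hout hout' hd (hdd.trans (min_le_right _ _)) with
    ⟨h1, h2⟩ | ⟨A, B, hP, S, q₁, q₁', hS, hSH, hq₁, hq₁', hf, hf', hdist⟩
  · refine ⟨t, le_rfl, by linarith, ?_⟩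
    rw [flow_eq_free (isTame_of_notMem hcl hout) fun s hs _ => h1 s hs,
      flow_eq_free (isTame_of_notMem hcl hout') fun s hs _ => h2 s hs]
    refine (dist_free_free_le ht hd).trans ?_
    have h3 : 1 + t ≤ L * C * (1 + t) := by nlinarith [one_le_mul_of_one_le_of_one_le hL hC]
    have h4 : L * C * (1 + t) ≤ L * C * (1 + t) * L ^ n :=
      le_mul_of_one_le_right (by positivity) hLn
    have h5 := h3.trans h4
    gcongr
  · have h1 : C * √d * L ^ n ≤ η := by
      have h2 : √(d * L ^ (2 * n)) ≤ η / C :=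
        Real.sqrt_le_iff.2 ⟨by positivity, hdn.trans (min_le_right _ _)⟩
      rw [Real.sqrt_mul hd0, mul_comm 2 n, pow_mul, Real.sqrt_sq (by positivity),
        le_div_iff₀ (by positivity)] at h2
      linarith
    have h0 : 0 ≤ n * (D / (2 * β)) := ht.trans htn
    obtain ⟨t', h2, h3, h4⟩ := comp Θ₁ Θ₂ n B A hP.symm q₁ q₁' (C * √d) (max (t - S) 0) hq₁ hq₁'
      hdist h1 (le_max_right _ _) (max_le (by linarith) h0)
    have h5 := le_max_left (t - S) 0
    have h6 := le_max_right (t - S) 0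
    have h7 : max (t - S) 0 ≤ t + H - S := max_le (by linarith) (by linarith)
    refine ⟨S + t', by linarith, by linarith, ?_⟩
    rw [hf _ (by linarith), hf' _ (by linarith)]
    refine h4.trans ?_
    have h8 : √(C * √d) ≤ C * √√d := by
      rw [Real.sqrt_mul (by linarith)]
      gcongr
      exact Real.sqrt_le_left (by linarith) |>.2 (by nlinarith)
    have h9 : 0 ≤ 1 + (S + t') := by linarith
    calc L * (1 + t') * L ^ n * √(C * √d) ≤ L * (1 + (S + t')) * L ^ n * (C * √√d) := by
          gcongr; linarith
      _ = _ := by ring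

/-! ### Choice of the constants and conclusion -/

theorem phaseDist_le (p q : Phase) : phaseDist p q ≤ 2 * dist p q := by
  have h1 : dist p.1 q.1 ≤ dist p q := le_max_left _ _
  have h2 : dist p.2 q.2 ≤ dist p q := le_max_right _ _
  have h3 : (0 : ℝ) ≤ dist p.1 q.1 := dist_nonneg
  have h4 : (0 : ℝ) ≤ dist p.2 q.2 := dist_nonneg
  exact Real.sqrt_le_iff.2 ⟨by positivity, by nlinarith⟩

theorem dist_le_phaseDist (p q : Phase) : dist p q ≤ phaseDist p q := by
  rw [Prod.dist_eq, max_le_iff]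
  exact ⟨Real.le_sqrt_of_sq_le (by nlinarith [sq_nonneg (dist p.2 q.2)]),
    Real.le_sqrt_of_sq_le (by nlinarith [sq_nonneg (dist p.1 q.1)])⟩

/-- Two disjoint obstacles form a pair of round sets. -/
theorem exists_isPair {Θ₁ Θ₂ : Set E3} (h₁ : IsObstacle Θ₁) (h₂ : IsObstacle Θ₂)
    (hdisj : Disjoint Θ₁ Θ₂) :
    ∃ r D R₀ : ℝ, 0 < r ∧ 0 < D ∧ ∀ R, R₀ ≤ R → IsPair Θ₁ Θ₂ Θ₁ Θ₂ r D R := by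
  obtain ⟨r₁, hr₁⟩ := h₁.exists_isRound
  obtain ⟨r₂, hr₂⟩ := h₂.exists_isRound
  have h1 : IsRound Θ₁ (normalAt Θ₁ Θ₂) r₁ := hr₁.congr fun y hy => if_pos hy
  have h2 : IsRound Θ₂ (normalAt Θ₁ Θ₂) r₂ :=
    hr₂.congr fun y hy => if_neg fun hy' => hdisj.notMem_of_mem_left hy' hy
  obtain ⟨D, hD0, hD⟩ := (h₁.isCompact.prod h₂.isCompact).exists_forall_le'
    (f := fun p : E3 × E3 => dist p.1 p.2) (a := 0) (by fun_prop) fun p hp =>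
      dist_pos.2 fun h => hdisj.notMem_of_mem_left hp.1 (h ▸ hp.2)
  obtain ⟨R, hR⟩ := (h₁.isCompact.union h₂.isCompact).isBounded.exists_norm_le
  have hr : 0 < min r₁ r₂ := lt_min h1.pos h2.pos
  exact ⟨min r₁ r₂, D, R, hr, hD0, fun R' hR' => ⟨rfl, h1.mono hr (min_le_left _ _),
    h2.mono hr (min_le_right _ _), hD0, fun a ha b hb => hD (a, b) ⟨ha, hb⟩,
    fun z hz => (hR z hz).trans hR'⟩⟩

/-- Polynomial and exponential factors are absorbed by a single exponential. -/
theorem exists_exp_bound {Q L G : ℝ} (hQ : 0 ≤ Q) (hL : 1 ≤ L) :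
    ∃ C : ℝ, 0 < C ∧ ∀ (n : ℕ) (t : ℝ), 1 ≤ t → (n : ℝ) ≤ t / G + 1 →
      Q * (1 + t) * L ^ n ≤ C ^ t := by
  refine ⟨Real.exp (Q * L + 1 + Real.log L / G), Real.exp_pos _, fun n t ht hn => ?_⟩
  have hL0 : 0 < L := by linarith
  have h1 : L ^ n ≤ L * Real.exp (Real.log L / G * t) := by
    calc L ^ n = Real.exp (Real.log L * n) := by
          rw [mul_comm, Real.exp_nat_mul, Real.exp_log hL0]
      _ ≤ Real.exp (Real.log L * (t / G + 1)) := by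
          have := Real.log_nonneg hL
          gcongr
      _ = Real.exp (Real.log L) * Real.exp (Real.log L / G * t) := by
          rw [← Real.exp_add]; congr 1; ring
      _ = _ := by rw [Real.exp_log hL0]
  have h2 : 1 + t ≤ Real.exp t := by linarith [Real.add_one_le_exp t]
  have hQL : 0 ≤ Q * L := by positivity
  -- This needs `t ≥ 1`: near `t = 0` no `C ^ t` absorbs a large constant.
  have h3 : Q * L ≤ Real.exp (Q * L * t) := by
    have h4 := Real.add_one_le_exp (Q * L * t)
    have h5 : Q * L ≤ Q * L * t := le_mul_of_one_le_right hQL ht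
    linarith
  have h0 : 0 ≤ 1 + t := by linarith
  calc Q * (1 + t) * L ^ n ≤ Q * (1 + t) * (L * Real.exp (Real.log L / G * t)) := by gcongr
    _ = Q * L * (1 + t) * Real.exp (Real.log L / G * t) := by ring
    _ ≤ Real.exp (Q * L * t) * Real.exp t * Real.exp (Real.log L / G * t) := by gcongr
    _ = _ := by
      rw [← Real.exp_add, ← Real.exp_add, ← Real.exp_mul]; congr 1; ring

theorem sqrt_sqrt_eq_rpow {d : ℝ} (hd : 0 ≤ d) : √√d = d ^ (1 / 4 : ℝ) := by
  rw [Real.sqrt_eq_rpow, Real.sqrt_eq_rpow, ← Real.rpow_mul hd]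
  norm_num

end Billiard

theorem lemma3p3 (Θ₁ Θ₂ : Set Billiard.E3)
    (hΘ₁ : Billiard.IsObstacle Θ₁) (hΘ₂ : Billiard.IsObstacle Θ₂) (hdisj : Disjoint Θ₁ Θ₂)
    (α₀ β₀ : ℝ) (hα₀ : 0 < α₀) (hβ₀ : 0 < β₀)
    (V : Set Billiard.E3) (hVb : Bornology.IsBounded V) (hVo : IsOpen V)
    (hV : convexHull ℝ (Θ₁ ∪ Θ₂) ⊆ V) :
    ∃ α C τ : ℝ, 0 < α ∧ 0 < C ∧ 0 < τ ∧
      ∀ x ∈ V \ (Θ₁ ∪ Θ₂), ∀ x' ∈ V \ (Θ₁ ∪ Θ₂),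
      ∀ ξ ξ' : Billiard.E3, ‖ξ‖ ∈ Set.Icc α₀ β₀ → ‖ξ'‖ ∈ Set.Icc α₀ β₀ →
      ∀ t : ℝ, 0 < t → ∃ t' : ℝ, 0 ≤ t' ∧ |t' - t| ≤ τ ∧
        Billiard.phaseDist (Billiard.flow Θ₁ Θ₂ t' (x', ξ')) (Billiard.flow Θ₁ Θ₂ t' (x, ξ)) ≤
          C ^ t' * Billiard.phaseDist (x', ξ') (x, ξ) ^ α := by
  open Billiard in
  obtain ⟨r, D, R₀, hr, hD, hpair⟩ := exists_isPair hΘ₁ hΘ₂ hdisj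
  obtain ⟨R₁, hR₁⟩ := hVb.exists_norm_le
  set R := max (max R₀ R₁) 0 with hRdef
  have hR : 0 ≤ R := le_max_right _ _
  have hP := hpair R ((le_max_left _ _).trans (le_max_left _ _))
  have hVR : ∀ x ∈ V, ‖x‖ ≤ R := fun x hx =>
    (hR₁ x hx).trans ((le_max_right _ _).trans (le_max_left _ _))
  obtain ⟨L, hL, K, hK, d₁, hd₁, comp⟩ := exists_comparison (β := β₀) hr hD hα₀ hR
  set H := (2 * R + D) / α₀ with hH
  have hH0 : 0 < H := by positivity
  set G := D / (2 * β₀) with hG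
  have hG0 : 0 < G := by positivity
  set M := 2 * (2 * R + 2 * β₀) / √√d₁ with hM
  have hM0 : 0 ≤ M := by positivity
  obtain ⟨C, hC0, hC⟩ := exists_exp_bound (Q := 2 * K + M) (L := L) (G := G) (by positivity) hL
  -- Two square roots give 1/4. In the delay, 1 comes from aiming at time `t + 1`, so that `t' ≥ 1`,
  -- and `2 * H` from the synchronizations.
  refine ⟨1 / 4, C, 1 + 2 * H, by norm_num, hC0, by positivity, ?_⟩
  intro x hx x' hx' ξ ξ' hξ hξ' t ht
  set ε := phaseDist (x', ξ') (x, ξ) with hε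
  have hε0 : 0 ≤ ε := Real.sqrt_nonneg _
  set n := ⌈(t + 1) / G⌉₊ with hn
  have hn1 : t + 1 ≤ n * G := by
    rw [← div_le_iff₀ hG0]; exact Nat.le_ceil _
  have hn2 : (n : ℝ) ≤ (t + 1) / G + 1 := (Nat.ceil_lt_add_one (by positivity)).le
  rw [← sqrt_sqrt_eq_rpow hε0]
  have hss : 0 ≤ √√ε := Real.sqrt_nonneg _
  suffices h : ∃ t', t + 1 ≤ t' ∧ t' ≤ t + 1 + 2 * H ∧
      phaseDist (flow Θ₁ Θ₂ t' (x', ξ')) (flow Θ₁ Θ₂ t' (x, ξ)) ≤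
        (2 * K + M) * (1 + t') * L ^ n * √√ε by
    obtain ⟨t', h1, h2, h3⟩ := h
    refine ⟨t', by linarith, abs_le.2 ⟨by linarith, by linarith⟩, h3.trans ?_⟩
    have h4 : (n : ℝ) ≤ t' / G + 1 := hn2.trans (by gcongr)
    exact mul_le_mul_of_nonneg_right (hC n t' (by linarith) h4) hss
  by_cases hsmall : ε * L ^ (2 * n) ≤ d₁
  · obtain ⟨t', h1, h2, h3⟩ := comp Θ₁ Θ₂ Θ₁ Θ₂ hP n (x', ξ') (x, ξ) ε (t + 1) hξ' hξ
      ((hVR x' hx'.1).trans (by linarith)) ((hVR x hx.1).trans (by linarith)) hx'.2 hx.2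
      (dist_le_phaseDist _ _) hsmall (by linarith) hn1
    refine ⟨t', h1, h2, (phaseDist_le _ _).trans ?_⟩
    have ht' : 0 ≤ 1 + t' := by linarith
    calc _ ≤ 2 * (K * (1 + t') * L ^ n * √√ε) := by gcongr
      _ = (2 * K) * (1 + t') * L ^ n * √√ε := by ring
      _ ≤ _ := by gcongr; linarith
  -- Now `L ^ n * √√ε` is at least `√√d₁`, so the linear growth of the flow is enough.
  · push Not at hsmall
    refine ⟨t + 1, le_rfl, by linarith, (phaseDist_le _ _).trans ?_⟩
    have hcl : IsClosed (Θ₁ ∪ Θ₂) := hP.isClosed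
    obtain ⟨h1, h2⟩ := hP.flow_bound (q := (x, ξ)) (t := t + 1) (isTame_of_notMem hcl hx.2)
      (ne_zero_of_speed hα₀ hξ) (by linarith)
    obtain ⟨h3, h4⟩ := hP.flow_bound (q := (x', ξ')) (t := t + 1) (isTame_of_notMem hcl hx'.2)
      (ne_zero_of_speed hα₀ hξ') (by linarith)
    have hpos : ∀ y η : E3, ∀ z : E3, ‖y‖ ≤ R → ‖η‖ ≤ β₀ → ‖z - y‖ ≤ (t + 1) * ‖η‖ →
        ‖z‖ ≤ R + (t + 1) * β₀ := fun y η z hy hη hz => by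
      have h5 : z = (z - y) + y := by abel
      have h6 : (t + 1) * ‖η‖ ≤ (t + 1) * β₀ := by gcongr
      rw [h5]
      exact (norm_add_le _ _).trans (by linarith)
    have h5 := hpos x ξ _ (hVR x hx.1) hξ.2 h1
    have h6 := hpos x' ξ' _ (hVR x' hx'.1) hξ'.2 h3
    have h7 : dist (flow Θ₁ Θ₂ (t + 1) (x', ξ')) (flow Θ₁ Θ₂ (t + 1) (x, ξ)) ≤
        (2 * R + 2 * β₀) * (1 + (t + 1)) := by
      rw [Prod.dist_eq, max_le_iff, dist_eq_norm, dist_eq_norm]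
      have h8 : 0 ≤ R * t := by positivity
      have h9 : 0 ≤ β₀ * t := by positivity
      constructor
      · exact (norm_sub_le _ _).trans (by linarith)
      · have h10 := hξ.2
        have h11 := hξ'.2
        refine (norm_sub_le _ _).trans ?_
        rw [h2, h4]
        linarith
    have hs1 : 0 < √√d₁ := by positivity
    have h8 : √√d₁ ≤ L ^ n * √√ε := by
      calc √√d₁ ≤ √√(ε * L ^ (2 * n)) := by gcongr
        _ = √√ε * √(L ^ n) := by
          rw [Real.sqrt_mul hε0, mul_comm 2 n, pow_mul, Real.sqrt_sq (by positivity),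
            Real.sqrt_mul (Real.sqrt_nonneg _)]
        _ ≤ √√ε * L ^ n := by
          gcongr
          exact Real.sqrt_le_left (by positivity) |>.2 (by nlinarith [one_le_pow₀ hL (n := n)])
        _ = _ := mul_comm _ _
    calc _ ≤ 2 * ((2 * R + 2 * β₀) * (1 + (t + 1))) := by gcongr
      _ = M * (1 + (t + 1)) * √√d₁ := by rw [hM]; field_simp
      _ ≤ M * (1 + (t + 1)) * (L ^ n * √√ε) := by gcongr
      _ = M * (1 + (t + 1)) * L ^ n * √√ε := by ring
      _ ≤ _ := by gcongr; linarith
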